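/- Let $(C^{(n)})_{n\in\mathbb N}$ be a sequence of 3-term chain complexes $$C_2^{(n)}\xrightarrow{\ \partial_2\ }C_1^{(n)}\xrightarrow{\ \partial_1\ }C_0^{(n)},\qquad \partial_1\partial_2=0,\qquad C_k^{(n)}=\mathbb F_2^{\,n_k},$$ with standard bases (the dimensions $n_k$ and the maps depend on $n$), such that $n_1\to\infty$ as $n\to\infty$. Write $|x|$ for Hamming weight. Let $\varepsilon,\mu>0$ be independent of $n$. Call a pair of composable linear maps $\mathbb F_2^{a}\xrightarrow{f}\mathbb F_2^{b}\xrightarrow{g}\mathbb F_2^{c}$ with $gf=0$ *$(\varepsilon,\mu)$-expanding* if, with $Z=\ker g$ and $B=\operatorname{im} f$, $$|x|\ge \mu\, b\ \text{ for all } x\in Z\setminus B,\qquad \frac{|g(x)|}{c}\ \ge\ \varepsilon\,\frac{\min_{z\in Z}|x+z|}{b}\ \text{ for all } x\in\mathbb F_2^{b}\setminus Z .$$ Suppose that each $C^{(n)}$ is an $(\varepsilon,\mu)$ systole/co-systole expander in the middle degree, i.e. both $(\partial_2,\partial_1)$ (systole) and $(\partial_1^T,\partial_2^T)$ (co-systole)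 are $(\varepsilon,\mu)$-expanding. Suppose also that $\ker\partial_1\ne\operatorname{im}\partial_2$ for every $n$ (the associated code has at least one logical qubit), and that there is a constant $q$ such that, for all $n$, every row of $\partial_1$ and every column of $\partial_2$ has at most $q$ nonzero entries. Associate with $C^{(n)}$ the CSS Hamiltonian on $n_1$ qubits $$H_n=\frac1{2n_0}\sum_{i=1}^{n_0}\frac{I-X^{\partial_1^Te_i}}2+\frac1{2n_2}\sum_{j=1}^{n_2}\frac{I-Z^{\partial_2e_j}}2,$$ where $X^v=\bigotimes_i X^{v_i}$, $Z^v=\bigotimes_iZ^{v_i}$ (an empty sum contributes $0$). Then $\{H_n\}$ is an NLTS Hamiltonian family. That is: (i) there is a constant $k$ such that every $H_n$ is a $k$-local Hamiltonian, i.e. $H_n=\frac1m\sum_{i=1}^mT_i$ for some $m\geq 1$, where $0\preceq T_i\preceq I$ and $T_i=h_i\otimes I$ with $h_i\succeq0$ acting on at most $k$ qubits; (ii) there is a constant $\varepsilon'>0$ such that for every depth $d$ and all sufficiently large $n$, every depth-$d$ trivial state $\rho$ on $n_1$ qubits satisfies $$\operatorname{tr}(\rho H_n)>\lambda_{\min}(H_n)+\varepsilon'.$$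 Here a state is *depth-$d$ trivial* if, for some number of ancilla qubits, it is obtained from $|0\cdots0\rangle$ on all the qubits by applying $d$ layers, each a tensor product of two-qubit unitary gates on pairwise disjoint (arbitrary) pairs of qubits, and then tracing out the ancillas. -/

import Mathlib

open Matrix Filter
open scoped ComplexOrder

namespace HighDimNLTS

/-! ### Chain complexes over `𝔽₂` and systole / co-systole expansion -/

/-- A chain complex `C₂ → C₁ → C₀` of based finite-dimensional spaces over `𝔽₂`,
with `C_k = 𝔽₂ ^ n_k` and boundary maps given by their matrices. -/
structure ThreeTermComplex where
  n0 : ℕ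
  n1 : ℕ
  n2 : ℕ
  bd1 : Matrix (Fin n0) (Fin n1) (ZMod 2)
  bd2 : Matrix (Fin n1) (Fin n2) (ZMod 2)
  bd_comp : bd1 * bd2 = 0

/-- Distance (in Hamming weight) from `x` to a subspace `Z`: the minimum of `|x + z|`, `z ∈ Z`. -/
noncomputable def distTo {b : ℕ} (x : Fin b → ZMod 2) (Z : Submodule (ZMod 2) (Fin b → ZMod 2)) :
    ℕ :=
  ⨅ z : Z, hammingNorm (x + z.1)

/-- For `f : 𝔽₂^a → 𝔽₂^b` and `g : 𝔽₂^b → 𝔽₂^c` put `B = im f` and `Z = ker g`.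
The pair is `(ε, μ)`-expanding if every element of `Z - B` has weight at least `μ b` and if,
for every `x ∉ Z`, the relative weight of `g x` is at least `ε` times the relative distance of
`x` to `Z`. -/
def IsExpanding {a b c : ℕ} (f : Matrix (Fin b) (Fin a) (ZMod 2))
    (g : Matrix (Fin c) (Fin b) (ZMod 2)) (ε μ : ℝ) : Prop :=
  (∀ x : Fin b → ZMod 2, x ∈ LinearMap.ker g.mulVecLin → x ∉ LinearMap.range f.mulVecLin →
      μ * (b : ℝ) ≤ (hammingNorm x : ℝ)) ∧
  (∀ x : Fin b → ZMod 2, x ∉ LinearMap.ker g.mulVecLin →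
      ε * ((distTo x (LinearMap.ker g.mulVecLin) : ℝ) / (b : ℝ)) ≤
        (hammingNorm (g *ᵥ x) : ℝ) / (c : ℝ))

namespace ThreeTermComplex

/-- Systole expansion in the middle degree: the condition for the boundary maps
`C₂ → C₁ → C₀`. -/
def IsSystoleExpander (C : ThreeTermComplex) (ε μ : ℝ) : Prop :=
  IsExpanding C.bd2 C.bd1 ε μ

/-- Co-systole expansion in the middle degree: the condition for the co-boundary maps
`C⁰ → C¹ → C²`, the transposes of the boundary maps. -/
def IsCosystoleExpander (C : ThreeTermComplex) (ε μ : ℝ) : Prop :=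
  IsExpanding C.bd1ᵀ C.bd2ᵀ ε μ

/-- The middle homology `ker ∂₁ / im ∂₂` is nonzero. -/
def HasNontrivialMiddleHomology (C : ThreeTermComplex) : Prop :=
  LinearMap.range C.bd2.mulVecLin ≠ LinearMap.ker C.bd1.mulVecLin

/-- The `𝔽₂`-vector of the `X` check attached to a basis element of `C₀`: `∂₁ᵀ` of it. -/
def xCheck (C : ThreeTermComplex) (i : Fin C.n0) : Fin C.n1 → ZMod 2 :=
  C.bd1ᵀ *ᵥ Pi.single i 1

/-- The `𝔽₂`-vector of the `Z` check attached to a basis element of `C₂`: `∂₂` of it. -/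
def zCheck (C : ThreeTermComplex) (j : Fin C.n2) : Fin C.n1 → ZMod 2 :=
  C.bd2 *ᵥ Pi.single j 1

/-- Every check involves at most `q` qubits. -/
def HasCheckWeightAtMost (C : ThreeTermComplex) (q : ℕ) : Prop :=
  (∀ i, hammingNorm (C.xCheck i) ≤ q) ∧ (∀ j, hammingNorm (C.zCheck j) ≤ q)

end ThreeTermComplex

/-! ### Qubits

Operators on the qubits labelled by `Q` are matrices indexed by the computational basis
`Q → ZMod 2`. -/

/-- Operators on the qubits labelled by `Q`. -/
abbrev Op (Q : Type) : Type := Matrix (Q → ZMod 2) (Q → ZMod 2) ℂ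

/-- The Pauli matrix `X`. -/
def pauliX : Matrix (ZMod 2) (ZMod 2) ℂ := Matrix.of fun r c => if r = c then 0 else 1

/-- The Pauli matrix `Z`. -/
def pauliZ : Matrix (ZMod 2) (ZMod 2) ℂ := Matrix.diagonal fun r => if r = 0 then 1 else -1

/-- Tensor product of one-qubit operators. -/
def tensor {Q : Type} [Fintype Q] (A : Q → Matrix (ZMod 2) (ZMod 2) ℂ) : Op Q :=
  Matrix.of fun r c => ∏ i, A i (r i) (c i)

/-- `X^e = ⨂ X^{e_i}`. -/
def xPauli {Q : Type} [Fintype Q] (e : Q → ZMod 2) : Op Q :=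
  tensor fun i => if e i = 1 then pauliX else 1

/-- `Z^e = ⨂ Z^{e_i}`. -/
def zPauli {Q : Type} [Fintype Q] (e : Q → ZMod 2) : Op Q :=
  tensor fun i => if e i = 1 then pauliZ else 1

/-- The operator `h ⊗ I`, with `h` on the qubits in `S` and the identity on the others. -/
def extend {Q : Type} [Fintype Q] [DecidableEq Q] (S : Finset Q) (h : Op S) : Op Q :=
  Matrix.of fun r c =>
    if ∀ i, i ∉ S → r i = c i then h (fun i => r i) (fun i => c i) else 0

/-- `H = (1/m) ∑ H_i` with `0 ≤ H_i ≤ 1` and each `H_i = h_i ⊗ I`, `h_i ≥ 0` on at most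
`k` qubits. -/
def IsLocalHamiltonian {Q : Type} [Fintype Q] [DecidableEq Q] (k : ℕ) (H : Op Q) : Prop :=
  ∃ (m : ℕ) (T : Fin m → Op Q), 0 < m ∧ H = (1 / (m : ℂ)) • ∑ i, T i ∧
    ∀ i, (T i).PosSemidef ∧ (1 - T i).PosSemidef ∧
      ∃ (S : Finset Q) (h : Op S), S.card ≤ k ∧ h.PosSemidef ∧ T i = extend S h

/-- The smallest eigenvalue (of a Hermitian operator). -/
noncomputable def lambdaMin {Q : Type} [Fintype Q] [DecidableEq Q] (H : Op Q) : ℝ :=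
  sInf (spectrum ℝ H)

/-- The Hamiltonian of the CSS code attached to a three-term complex: qubits are the basis
elements of `C₁`, and
`H = (1 / 2 n₀) ∑ (1 - X^{∂₁ᵀ e_i}) / 2 + (1 / 2 n₂) ∑ (1 - Z^{∂₂ e_j}) / 2`.
If one of the two groups of checks is empty, its contribution is zero. -/
noncomputable def ThreeTermComplex.hamiltonian (C : ThreeTermComplex) : Op (Fin C.n1) :=
  (1 / (2 * (C.n0 : ℂ))) • ∑ i, (1 / 2 : ℂ) • (1 - xPauli (C.xCheck i)) +
    (1 / (2 * (C.n2 : ℂ))) • ∑ j, (1 / 2 : ℂ) • (1 - zPauli (C.zCheck j))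

/-! ### Circuits and trivial states -/

/-- A circuit layer: two-qubit unitary gates on pairwise disjoint pairs of qubits. -/
structure Layer (Q : Type) [Fintype Q] [DecidableEq Q] where
  pairs : Finset (Finset Q)
  card_pair : ∀ p ∈ pairs, p.card = 2
  disjoint_pairs : ∀ p ∈ pairs, ∀ p' ∈ pairs, p ≠ p' → Disjoint p p'
  gate : ∀ p : Finset Q, Op p
  gate_unitary : ∀ p ∈ pairs, gate p ∈ Matrix.unitaryGroup (p → ZMod 2) ℂ

/-- The operator of a layer: the tensor product of its gates, and of the identity on the qubits
that no gate touches. -/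
def Layer.toOp {Q : Type} [Fintype Q] [DecidableEq Q] (L : Layer Q) : Op Q :=
  Matrix.of fun r c =>
    if ∀ i, (∀ p ∈ L.pairs, i ∉ p) → r i = c i then
      ∏ p ∈ L.pairs, L.gate p (fun i => r i) (fun i => c i)
    else 0

/-- The operator of a circuit; its depth is the number of layers. -/
def circuitOp {Q : Type} [Fintype Q] [DecidableEq Q] (Ls : List (Layer Q)) : Op Q :=
  (Ls.map Layer.toOp).prod

/-- The state vector obtained by applying a circuit to `|0…0⟩`. -/
def circuitState {Q : Type} [Fintype Q] [DecidableEq Q] (Ls : List (Layer Q)) :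
    (Q → ZMod 2) → ℂ :=
  circuitOp Ls *ᵥ Pi.single 0 1

/-- Partial trace over the qubits labelled by `A`. -/
def partialTrace {Q A : Type} [Fintype A] [DecidableEq A] (M : Op (Q ⊕ A)) : Op Q :=
  Matrix.of fun r c => ∑ a : A → ZMod 2, M (Sum.elim r a) (Sum.elim c a)

/-- `ρ` is depth-`d` trivial: for some number of ancilla qubits, it is the reduced state of
`U |0…0⟩⟨0…0| U†` for a circuit `U` of depth `d`. -/
def IsTrivialState {Q : Type} [Fintype Q] [DecidableEq Q] (d : ℕ) (ρ : Op Q) : Prop :=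
  ∃ (a : ℕ) (Ls : List (Layer (Q ⊕ Fin a))), Ls.length = d ∧
    ρ = partialTrace (Matrix.vecMulVec (circuitState Ls) (star (circuitState Ls)))

/-- No low-energy trivial states: the Hamiltonians are `k`-local for one fixed `k`, and for some
constant `ε > 0` and every depth `d`, for all sufficiently large `n` every depth-`d` trivial
state has energy more than `ε` above the minimum. -/
def IsNLTS (N : ℕ → ℕ) (H : ∀ n, Op (Fin (N n))) : Prop :=
  (∃ k : ℕ, ∀ n, IsLocalHamiltonian k (H n)) ∧
  ∃ ε : ℝ, 0 < ε ∧ ∀ d : ℕ, ∀ᶠ n in atTop, ∀ ρ : Op (Fin (N n)), IsTrivialState d ρ →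
    lambdaMin (H n) + ε < ((ρ * H n).trace).re

end HighDimNLTS

/-! The energy of a state is half the sum of two expected relative syndrome weights: that of `∂₂ᵀ`
on its computational-basis outcomes and that of `∂₁` on its outcomes after a Hadamard on every
qubit. Both outcome distributions come from shallow circuits, of depth `d` and `d + 1`.

Expansion makes low energy force each distribution near its code space. Choose `a ∈ ker ∂₁ \ im ∂₂`
and `b ∈ ker ∂₂ᵀ` with `a ⬝ b = 1`. Decoding an outcome by a minimum-weight coset leader and pairing
with `a`, respectively `b`, gives two ±1-valued observables. They anticommute exactly, on and off
the code space (`diagonal_anticommute_walsh_conj`), so the squares of their means sum to at most 1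
(`sq_mean_add_sq_mean_le_one`).

Hence in one basis both decoded values have constant probability. By the systole or co-systole
bound, the two sets of outcomes are at distance linear in `n₁`, so the distance to one of them is a
1-Lipschitz function with variance of order `n₁²`. A shallow circuit allows variance only `4 ^ depth
* n₁` (`sum_sq_le_of_lipschitz`, a Poincaré inequality proved with light cones), whatever the number
of ancillas. For large `n₁` this is a contradiction, packaged in `IsExpanding.half_lt_sq_mean_sign`:
at low energy each squared mean would exceed 1/2. -/

namespace HighDimNLTS

section Extend

variable {V : Type} [Fintype V] [DecidableEq V]

/-! ### Operators supported on a set of qubits -/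

/-- Splitting configurations into their bits in `S` and outside `S` turns `h ⊗ I` into a Kronecker
product, whose algebraic rules then transfer. -/
theorem extend_eq_kronecker (S : Finset V) (h : Op S) :
    extend S h = (kroneckerMap (· * ·) h (1 : Matrix ({i // i ∉ S} → ZMod 2) _ ℂ)).submatrix
      (Equiv.piEquivPiSubtypeProd (· ∈ S) fun _ => ZMod 2)
      (Equiv.piEquivPiSubtypeProd (· ∈ S) fun _ => ZMod 2) := by
  ext r c
  simp only [extend, of_apply, submatrix_apply, kroneckerMap_apply, one_apply,
    Equiv.piEquivPiSubtypeProd_apply, funext_iff, Subtype.forall, mul_ite, mul_one, mul_zero]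

theorem extend_mul (S : Finset V) (h k : Op S) :
    extend S h * extend S k = extend S (h * k) := by
  rw [extend_eq_kronecker, extend_eq_kronecker, extend_eq_kronecker, submatrix_mul_equiv,
    ← mul_kronecker_mul, one_mul]

theorem extend_one (S : Finset V) : extend S (1 : Op S) = 1 := by
  rw [extend_eq_kronecker, one_kronecker_one, submatrix_one_equiv]

theorem extend_conjTranspose (S : Finset V) (h : Op S) :
    (extend S h)ᴴ = extend S hᴴ := by
  rw [extend_eq_kronecker, extend_eq_kronecker, conjTranspose_submatrix, conjTranspose_kronecker,
    conjTranspose_one]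

theorem extend_sub (S : Finset V) (h k : Op S) : extend S (h - k) = extend S h - extend S k := by
  ext r c
  simp only [extend, of_apply, Matrix.sub_apply]
  split_ifs <;> simp

theorem extend_smul (S : Finset V) (a : ℂ) (h : Op S) : extend S (a • h) = a • extend S h := by
  ext r c
  simp only [extend, of_apply, Matrix.smul_apply]
  split_ifs <;> simp

theorem extend_mem_unitaryGroup {S : Finset V} {h : Op S}
    (hh : h ∈ unitaryGroup (S → ZMod 2) ℂ) : extend S h ∈ unitaryGroup (V → ZMod 2) ℂ := by
  rw [mem_unitaryGroup_iff, star_eq_conjTranspose] at hh ⊢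
  rw [extend_conjTranspose, extend_mul, hh, extend_one]

theorem extend_diagonal (S : Finset V) (t : (S → ZMod 2) → ℂ) :
    extend S (diagonal t) = diagonal fun y => t fun i => y i := by
  ext r c
  simp only [extend, of_apply, diagonal_apply]
  by_cases h : r = c
  · subst h; simp
  · rw [if_neg h]
    split_ifs with h1 h2
    · exact absurd (funext fun i => by
        by_cases hi : i ∈ S
        · exact congrFun h2 ⟨i, hi⟩
        · exact h1 i hi) h
    · rfl
    · rfl

theorem extend_mul_extend_apply {S T : Finset V} (hST : Disjoint S T) (h : Op S) (k : Op T)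
    (r c : V → ZMod 2) :
    (extend S h * extend T k) r c =
      if ∀ i, i ∉ S → i ∉ T → r i = c i then
        h (fun i => r i) (fun i => c i) * k (fun i => r i) (fun i => c i) else 0 := by
  have hS : ∀ i : S, (i : V) ∉ T := fun i hi => Finset.disjoint_left.1 hST i.2 hi
  have hT : ∀ i : T, (i : V) ∉ S := fun i hi => Finset.disjoint_left.1 hST hi i.2
  -- A contributing intermediate configuration agrees with `r` off `S` and with `c` off `T`, hence
  -- with `c` on `S`; this determines it.
  rw [mul_apply, Finset.sum_eq_single (fun i => if i ∈ S then c i else r i)]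
  · simp only [extend, of_apply]
    rw [if_pos (by intro i hi; simp [hi])]
    by_cases hc : ∀ i, i ∉ S → i ∉ T → r i = c i
    · rw [if_pos hc, if_pos (by intro i hi; by_cases hi' : i ∈ S <;> simp [hi', hc i, hi])]
      congr 2 <;> funext i
      · simp
      · simp [hT i]
    · rw [if_neg hc, if_neg, mul_zero]
      intro h'
      refine hc fun i hi hi' => ?_
      simpa [hi] using h' i hi'
  · intro m _ hm
    by_contra hne
    refine hm (funext fun i => ?_)
    have h1 := left_ne_zero_of_mul hne
    have h2 := right_ne_zero_of_mul hne
    simp only [extend, of_apply, ne_eq, ite_eq_right_iff, Classical.not_imp] at h1 h2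
    by_cases hi : i ∈ S
    · simpa [hi] using h2.1 i (Finset.disjoint_left.1 hST hi)
    · simpa [hi] using (h1.1 i hi).symm
  · simp

theorem commute_extend {S T : Finset V} (hST : Disjoint S T) (h : Op S) (k : Op T) :
    Commute (extend S h) (extend T k) := by
  ext r c
  rw [extend_mul_extend_apply hST, extend_mul_extend_apply hST.symm]
  simp only [mul_comm]
  congr 1
  exact propext ⟨fun h i a b => h i b a, fun h i a b => h i b a⟩

/-- `A` commutes with every operator on qubits outside `S`. -/
def SupportedOn (S : Finset V) (A : Op V) : Prop :=
  ∀ (T : Finset V) (h : Op T), Disjoint S T → Commute A (extend T h)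

theorem SupportedOn.mono {S S' : Finset V} {A : Op V} (hA : SupportedOn S A) (h : S ⊆ S') :
    SupportedOn S' A :=
  fun T k hT => hA T k (hT.mono_left h)

theorem SupportedOn.mul {S : Finset V} {A B : Op V} (hA : SupportedOn S A)
    (hB : SupportedOn S B) : SupportedOn S (A * B) :=
  fun T k hT => (hA T k hT).mul_left (hB T k hT)

theorem supportedOn_extend (S : Finset V) (h : Op S) : SupportedOn S (extend S h) :=
  fun _ k hT => commute_extend hT h k

/-! ### Block layers -/

/-- The tensor product of the gates `g p`, `p ∈ P`. -/
def blockOp (P : Finset (Finset V)) (g : ∀ p : Finset V, Op p) : Op V :=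
  Matrix.of fun r c =>
    if ∀ i, (∀ p ∈ P, i ∉ p) → r i = c i then
      ∏ p ∈ P, g p (fun i => r i) (fun i => c i)
    else 0

theorem blockOp_empty (g : ∀ p : Finset V, Op p) : blockOp ∅ g = 1 := by
  ext r c
  simp [blockOp, one_apply, funext_iff]

/-- Peeling off one gate at a time makes induction over the blocks of a layer possible. -/
theorem blockOp_insert {P : Finset (Finset V)} {p : Finset V} (hp : p ∉ P)
    (hd : ∀ p' ∈ P, Disjoint p p') (g : ∀ p : Finset V, Op p) :
    blockOp (insert p P) g = extend p (g p) * blockOp P g := by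
  ext r c
  have hpP : ∀ i ∈ p, ∀ p' ∈ P, i ∉ p' := fun i hi p' hp' => Finset.disjoint_left.1 (hd p' hp') hi
  rw [mul_apply, Finset.sum_eq_single (fun i => if i ∈ p then c i else r i)]
  · simp only [extend, blockOp, of_apply]
    rw [if_pos (show ∀ i, i ∉ p → r i = if i ∈ p then c i else r i by intro i hi; simp [hi])]
    by_cases hc : ∀ i, (∀ p' ∈ insert p P, i ∉ p') → r i = c i
    · rw [if_pos hc, if_pos, Finset.prod_insert hp]
      · congr 1
        · congr 1; funext i; simp
        · refine Finset.prod_congr rfl fun p' hp' => ?_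
          congr 1; funext i
          have : (i : V) ∉ p := fun hi => hpP i hi p' hp' i.2
          simp [this]
      · intro i hi
        by_cases hi' : i ∈ p
        · simp [hi']
        · simpa [hi'] using hc i (by simpa [hi'] using hi)
    · rw [if_neg hc, if_neg, mul_zero]
      intro h'
      refine hc fun i hi => ?_
      rw [Finset.forall_mem_insert] at hi
      simpa [hi.1] using h' i hi.2
  · intro m _ hm
    by_contra hne
    refine hm (funext fun i => ?_)
    have h1 := left_ne_zero_of_mul hne
    have h2 := right_ne_zero_of_mul hne
    simp only [extend, blockOp, of_apply, ne_eq, ite_eq_right_iff, Classical.not_imp] at h1 h2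
    by_cases hi : i ∈ p
    · simpa [hi] using h2.1 i (hpP i hi)
    · simpa [hi] using (h1.1 i hi).symm
  · simp

/-- The qubits that share a block of `P` with a qubit of `S`, and `S` itself. -/
def nbhd (P : Finset (Finset V)) (S : Finset V) : Finset V :=
  Finset.univ.filter fun k => ∃ s ∈ S, s = k ∨ ∃ p ∈ P, s ∈ p ∧ k ∈ p

theorem mem_nbhd {P : Finset (Finset V)} {S : Finset V} {k : V} :
    k ∈ nbhd P S ↔ ∃ s ∈ S, s = k ∨ ∃ p ∈ P, s ∈ p ∧ k ∈ p := by
  simp [nbhd]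

theorem subset_nbhd (P : Finset (Finset V)) (S : Finset V) : S ⊆ nbhd P S :=
  fun k hk => mem_nbhd.2 ⟨k, hk, Or.inl rfl⟩

theorem nbhd_mono {P P' : Finset (Finset V)} (h : P ⊆ P') (S : Finset V) :
    nbhd P S ⊆ nbhd P' S := by
  intro k hk
  obtain ⟨s, hs, hk⟩ := mem_nbhd.1 hk
  exact mem_nbhd.2 ⟨s, hs, hk.imp_right fun ⟨p, hp, hsk⟩ => ⟨p, h hp, hsk⟩⟩

theorem mem_nbhd_singleton_comm {P : Finset (Finset V)} {j k : V} :
    k ∈ nbhd P {j} ↔ j ∈ nbhd P {k} := by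
  simp only [mem_nbhd, Finset.mem_singleton, exists_eq_left, eq_comm (a := j), and_comm]

theorem card_nbhd_singleton_le {P : Finset (Finset V)} (hcard : ∀ p ∈ P, p.card ≤ 2)
    (hdisj : ∀ p ∈ P, ∀ p' ∈ P, p ≠ p' → Disjoint p p') (j : V) :
    (nbhd P {j}).card ≤ 2 := by
  by_cases h : ∃ p ∈ P, j ∈ p
  · obtain ⟨p, hp, hj⟩ := h
    refine (Finset.card_le_card fun k hk => ?_).trans (hcard p hp)
    simp only [mem_nbhd, Finset.mem_singleton, exists_eq_left] at hk
    rcases hk with rfl | ⟨p', hp', hj', hk⟩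
    · exact hj
    · by_cases he : p = p'
      · exact he ▸ hk
      · exact absurd hj' (Finset.disjoint_left.1 (hdisj p hp p' hp' he) hj)
  · refine (Finset.card_le_card (t := {j}) fun k hk => ?_).trans (by simp)
    simp only [mem_nbhd, Finset.mem_singleton, exists_eq_left] at hk ⊢
    rcases hk with rfl | ⟨p, hp, hj, -⟩
    · rfl
    · exact absurd ⟨p, hp, hj⟩ h

theorem nbhd_eq_biUnion (P : Finset (Finset V)) (S : Finset V) :
    nbhd P S = S.biUnion fun s => nbhd P {s} := by
  ext k
  simp [mem_nbhd]

/-! ### Conjugation by circuits and light cones -/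

theorem blockOp_mem_unitaryGroup {P : Finset (Finset V)} {g : ∀ p : Finset V, Op p}
    (hdisj : ∀ p ∈ P, ∀ p' ∈ P, p ≠ p' → Disjoint p p')
    (hg : ∀ p ∈ P, g p ∈ unitaryGroup (p → ZMod 2) ℂ) :
    blockOp P g ∈ unitaryGroup (V → ZMod 2) ℂ := by
  induction P using Finset.induction_on with
  | empty => rw [blockOp_empty]; exact one_mem _
  | insert p P hp ih =>
    rw [blockOp_insert hp fun p' hp' => hdisj p (Finset.mem_insert_self _ _) p'
      (Finset.mem_insert_of_mem hp') fun h => hp (h ▸ hp')]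
    exact mul_mem (extend_mem_unitaryGroup (hg p (Finset.mem_insert_self _ _)))
      (ih (fun a ha b hb => hdisj a (Finset.mem_insert_of_mem ha) b (Finset.mem_insert_of_mem hb))
        fun a ha => hg a (Finset.mem_insert_of_mem ha))

/-- A gate whose block misses `S` also misses the neighbourhood built from the other blocks, so it
commutes through and cancels against its adjoint. A gate whose block meets `S` lives inside the
neighbourhood by definition. -/
theorem SupportedOn.blockOp_conj {P : Finset (Finset V)} {g : ∀ p : Finset V, Op p}
    (hdisj : ∀ p ∈ P, ∀ p' ∈ P, p ≠ p' → Disjoint p p')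
    (hg : ∀ p ∈ P, g p ∈ unitaryGroup (p → ZMod 2) ℂ) {S : Finset V} {A : Op V}
    (hA : SupportedOn S A) : SupportedOn (nbhd P S) (blockOp P g * A * (blockOp P g)ᴴ) := by
  induction P using Finset.induction_on with
  | empty => simpa [blockOp_empty] using hA.mono (subset_nbhd _ _)
  | insert p P hp ih =>
    have hd : ∀ p' ∈ P, Disjoint p p' := fun p' hp' => hdisj p (Finset.mem_insert_self _ _) p'
      (Finset.mem_insert_of_mem hp') fun h => hp (h ▸ hp')
    have ih := ih (fun a ha b hb => hdisj a (Finset.mem_insert_of_mem ha) b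
      (Finset.mem_insert_of_mem hb)) fun a ha => hg a (Finset.mem_insert_of_mem ha)
    have hsub : nbhd P S ⊆ nbhd (insert p P) S := nbhd_mono (Finset.subset_insert _ _) S
    have hE := extend_mem_unitaryGroup (hg p (Finset.mem_insert_self _ _))
    rw [mem_unitaryGroup_iff, star_eq_conjTranspose] at hE
    have key : blockOp (insert p P) g * A * (blockOp (insert p P) g)ᴴ =
        extend p (g p) * (blockOp P g * A * (blockOp P g)ᴴ) * (extend p (g p))ᴴ := by
      rw [blockOp_insert hp hd, conjTranspose_mul]
      simp only [mul_assoc]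
    rw [key]
    by_cases hpS : Disjoint p S
    · have hdn : Disjoint (nbhd P S) p := by
        rw [Finset.disjoint_left]
        intro k hk hkp
        obtain ⟨s, hs, rfl | ⟨p', hp', -, hk'⟩⟩ := mem_nbhd.1 hk
        · exact Finset.disjoint_left.1 hpS hkp hs
        · exact Finset.disjoint_left.1 (hd p' hp') hkp hk'
      rw [← (ih p (g p) hdn).eq, mul_assoc, hE, mul_one]
      exact ih.mono hsub
    · obtain ⟨s, hsp, hs⟩ := Finset.not_disjoint_iff.1 hpS
      have hpn : p ⊆ nbhd (insert p P) S := fun k hk =>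
        mem_nbhd.2 ⟨s, hs, Or.inr ⟨p, Finset.mem_insert_self _ _, hsp, hk⟩⟩
      rw [extend_conjTranspose]
      exact (((supportedOn_extend p _).mono hpn).mul (ih.mono hsub)).mul
        ((supportedOn_extend p _).mono hpn)

variable (V) in
/-- A circuit layer of unitary gates on disjoint blocks of at most two qubits. -/
structure BlockLayer where
  blocks : Finset (Finset V)
  card_le : ∀ p ∈ blocks, p.card ≤ 2
  disjoint_blocks : ∀ p ∈ blocks, ∀ p' ∈ blocks, p ≠ p' → Disjoint p p'
  gate : ∀ p : Finset V, Op p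
  gate_unitary : ∀ p ∈ blocks, gate p ∈ Matrix.unitaryGroup (p → ZMod 2) ℂ

/-- The operator of a block layer. -/
def BlockLayer.toOp (L : BlockLayer V) : Op V := blockOp L.blocks L.gate

/-- A layer of two-qubit gates as a block layer. -/
def Layer.toBlockLayer (L : Layer V) : BlockLayer V where
  blocks := L.pairs
  card_le p hp := (L.card_pair p hp).le
  disjoint_blocks := L.disjoint_pairs
  gate := L.gate
  gate_unitary := L.gate_unitary

/-- The operator of a circuit of block layers. -/
def blockCircuitOp (Ls : List (BlockLayer V)) : Op V := (Ls.map BlockLayer.toOp).prod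

theorem blockCircuitOp_cons (L : BlockLayer V) (Ls : List (BlockLayer V)) :
    blockCircuitOp (L :: Ls) = L.toOp * blockCircuitOp Ls := by
  simp [blockCircuitOp]

theorem blockCircuitOp_mem_unitaryGroup (Ls : List (BlockLayer V)) :
    blockCircuitOp Ls ∈ unitaryGroup (V → ZMod 2) ℂ := by
  refine list_prod_mem fun A hA => ?_
  obtain ⟨L, -, rfl⟩ := List.mem_map.1 hA
  exact blockOp_mem_unitaryGroup L.disjoint_blocks L.gate_unitary

/-- The light cone of `S` under a circuit of block layers. -/
def cone (Ls : List (BlockLayer V)) (S : Finset V) : Finset V :=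
  Ls.foldr (fun L T => nbhd L.blocks T) S

theorem SupportedOn.circuit_conj (Ls : List (BlockLayer V)) {S : Finset V} {A : Op V}
    (hA : SupportedOn S A) :
    SupportedOn (cone Ls S) (blockCircuitOp Ls * A * (blockCircuitOp Ls)ᴴ) := by
  induction Ls with
  | nil => simpa [blockCircuitOp, cone] using hA
  | cons L Ls ih =>
    have h := ih.blockOp_conj L.disjoint_blocks L.gate_unitary
    rw [blockCircuitOp_cons, conjTranspose_mul]
    simp only [mul_assoc] at h ⊢
    exact h

theorem card_cone_le (Ls : List (BlockLayer V)) (S : Finset V) :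
    (cone Ls S).card ≤ 2 ^ Ls.length * S.card := by
  induction Ls with
  | nil => simp [cone]
  | cons L Ls ih =>
    have : cone (L :: Ls) S = nbhd L.blocks (cone Ls S) := rfl
    rw [this, nbhd_eq_biUnion, List.length_cons, pow_succ]
    have := Finset.card_biUnion_le_card_mul (cone Ls S) (fun s => nbhd L.blocks {s}) 2
      fun s _ => card_nbhd_singleton_le L.card_le L.disjoint_blocks s
    nlinarith

/-- The relation of sharing a block is symmetric, so cones traced backwards also at most double with
each layer. -/
theorem card_mem_cone_le (Ls : List (BlockLayer V)) (j : V) :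
    (Finset.univ.filter fun i => j ∈ cone Ls {i}).card ≤ 2 ^ Ls.length := by
  induction Ls generalizing j with
  | nil =>
    refine (Finset.card_le_card (t := {j}) fun i hi => ?_).trans (by simp)
    simpa [cone, eq_comm] using hi
  | cons L Ls ih =>
    have hsub : (Finset.univ.filter fun i => j ∈ cone (L :: Ls) {i}) ⊆
        (nbhd L.blocks {j}).biUnion fun k => Finset.univ.filter fun i => k ∈ cone Ls {i} := by
      intro i hi
      have hi : j ∈ nbhd L.blocks (cone Ls {i}) := (Finset.mem_filter.1 hi).2
      rw [nbhd_eq_biUnion, Finset.mem_biUnion] at hi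
      obtain ⟨k, hk, hjk⟩ := hi
      simp only [Finset.mem_biUnion, Finset.mem_filter, Finset.mem_univ, true_and]
      exact ⟨k, mem_nbhd_singleton_comm.1 hjk, hk⟩
    calc _ ≤ _ := Finset.card_le_card hsub
      _ ≤ _ := Finset.card_biUnion_le_card_mul _ _ _ fun k _ => ih k
      _ ≤ 2 * 2 ^ Ls.length := Nat.mul_le_mul_right _
        (card_nbhd_singleton_le L.card_le L.disjoint_blocks j)
      _ = _ := by rw [List.length_cons, pow_succ, mul_comm]

/-- One factor `2 ^ depth` bounds the size of a cone; the other comes from double counting pairs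
`(i, j)` with `j ∈ M` in the cone of `i`. -/
theorem sum_card_cone_inter_sq_le (Ls : List (BlockLayer V)) (M : Finset V) :
    ∑ i, ((cone Ls {i} ∩ M).card) ^ 2 ≤ 4 ^ Ls.length * M.card := by
  have h1 : ∀ i, ((cone Ls {i} ∩ M).card) ^ 2 ≤ 2 ^ Ls.length * (cone Ls {i} ∩ M).card := by
    intro i
    rw [sq]
    refine Nat.mul_le_mul_right _ ((Finset.card_le_card Finset.inter_subset_left).trans ?_)
    simpa using card_cone_le Ls {i}
  have h2 : ∑ i, (cone Ls {i} ∩ M).card ≤ 2 ^ Ls.length * M.card := by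
    have : ∀ i, (cone Ls {i} ∩ M).card = ∑ j ∈ M, if j ∈ cone Ls {i} then 1 else 0 := by
      intro i
      rw [Finset.inter_comm, ← Finset.filter_mem_eq_inter, Finset.card_filter]
    simp_rw [this]
    rw [Finset.sum_comm]
    calc _ ≤ ∑ j ∈ M, 2 ^ Ls.length := Finset.sum_le_sum fun j _ => by
            rw [← Finset.card_filter]; exact card_mem_cone_le Ls j
      _ = _ := by simp [mul_comm]
  calc _ ≤ ∑ i, 2 ^ Ls.length * (cone Ls {i} ∩ M).card := Finset.sum_le_sum fun i _ => h1 i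
    _ = 2 ^ Ls.length * ∑ i, (cone Ls {i} ∩ M).card := by rw [Finset.mul_sum]
    _ ≤ 2 ^ Ls.length * (2 ^ Ls.length * M.card) := Nat.mul_le_mul_left _ h2
    _ = _ := by rw [← mul_assoc, ← mul_pow]; norm_num

/-! ### The variance of a Lipschitz function in the output of a shallow circuit -/

theorem dotProduct_star_self_eq {ι : Type} [Fintype ι] (v : ι → ℂ) :
    star v ⬝ᵥ v = ((∑ y, ‖v y‖ ^ 2 : ℝ) : ℂ) := by
  simp only [dotProduct, Pi.star_apply, Complex.ofReal_sum, Complex.ofReal_pow]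
  exact Finset.sum_congr rfl fun y _ => Complex.conj_mul' (v y)

theorem sum_norm_sq_mulVec {ι : Type} [Fintype ι] [DecidableEq ι] {U : Matrix ι ι ℂ}
    (hU : U ∈ unitaryGroup ι ℂ) (v : ι → ℂ) :
    ∑ y, ‖(U *ᵥ v) y‖ ^ 2 = ∑ y, ‖v y‖ ^ 2 := by
  rw [mem_unitaryGroup_iff', star_eq_conjTranspose] at hU
  have h : star (U *ᵥ v) ⬝ᵥ (U *ᵥ v) = star v ⬝ᵥ v := by
    rw [star_mulVec, ← dotProduct_mulVec, mulVec_mulVec, hU, one_mulVec]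
  rw [dotProduct_star_self_eq, dotProduct_star_self_eq] at h
  exact_mod_cast h

theorem sum_norm_sq_circuit (Ls : List (BlockLayer V)) :
    ∑ y, ‖(blockCircuitOp Ls *ᵥ Pi.single 0 1) y‖ ^ 2 = 1 := by
  rw [sum_norm_sq_mulVec (blockCircuitOp_mem_unitaryGroup Ls),
    Finset.sum_eq_single 0 (fun y _ hy => by simp [hy]) (by simp)]
  simp

/-- A Poincaré inequality: pulled back through the circuit, a mean-zero observable sends `|0…0⟩` to
a vector `v` orthogonal to it, and the weight of `v` on `y i ≠ 0` sees only the dependence of `f` on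
the cone of `i`. Only coordinates in `M` are charged, which later makes ancillas free. -/
theorem sum_sq_le_of_lipschitz (Ls : List (BlockLayer V)) (M : Finset V)
    (f : (V → ZMod 2) → ℝ)
    (hf : ∀ y y', |f y - f y'| ≤ ((M.filter fun i => y i ≠ y' i).card : ℝ))
    (hmean : ∑ y, ‖(blockCircuitOp Ls *ᵥ Pi.single 0 1) y‖ ^ 2 * f y = 0) :
    ∑ y, ‖(blockCircuitOp Ls *ᵥ Pi.single 0 1) y‖ ^ 2 * f y ^ 2 ≤
      4 ^ Ls.length * (M.card : ℝ) := by
  set U := blockCircuitOp Ls with hUdef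
  set φ : (V → ZMod 2) → ℂ := U *ᵥ Pi.single 0 1 with hφ
  have hU : U ∈ unitaryGroup (V → ZMod 2) ℂ := blockCircuitOp_mem_unitaryGroup Ls
  have hU' : Uᴴ ∈ unitaryGroup (V → ZMod 2) ℂ := Unitary.star_mem hU
  have hUU : Uᴴ * U = 1 := by rwa [mem_unitaryGroup_iff', star_eq_conjTranspose] at hU
  have hφ1 : ∑ y, ‖φ y‖ ^ 2 = 1 := sum_norm_sq_circuit Ls
  set F : Op V := diagonal fun y => (f y : ℂ) with hF
  set v : (V → ZMod 2) → ℂ := Uᴴ *ᵥ (F *ᵥ φ) with hv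
  have hnv : ∑ y, ‖v y‖ ^ 2 = ∑ y, ‖φ y‖ ^ 2 * f y ^ 2 := by
    rw [hv, sum_norm_sq_mulVec hU']
    refine Finset.sum_congr rfl fun y _ => ?_
    rw [hF, mulVec_diagonal, norm_mul, mul_pow, Complex.norm_real, Real.norm_eq_abs, sq_abs,
      mul_comm]
  -- The amplitude of `v` at `0` is the mean of `f`.
  have hv0 : v 0 = 0 := by
    have h1 : v 0 = star φ ⬝ᵥ (F *ᵥ φ) := by
      rw [hφ, star_mulVec, ← dotProduct_mulVec, ← hφ, ← hv]
      simp [dotProduct, Pi.single_apply, apply_ite]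
    have h2 : star φ ⬝ᵥ (F *ᵥ φ) = ((∑ y, ‖φ y‖ ^ 2 * f y : ℝ) : ℂ) := by
      simp only [dotProduct, hF, mulVec_diagonal, Pi.star_apply, Complex.ofReal_sum,
        Complex.ofReal_mul, Complex.ofReal_pow]
      refine Finset.sum_congr rfl fun y _ => ?_
      rw [← Complex.conj_mul' (φ y)]
      simp only [RCLike.star_def]
      ring
    rw [h1, h2, hmean, Complex.ofReal_zero]
  -- Union bound: every configuration in the support of `v` has a nonzero bit.
  have hcut : ∑ y, ‖v y‖ ^ 2 ≤ ∑ i, ∑ y : V → ZMod 2, if y i ≠ 0 then ‖v y‖ ^ 2 else 0 := by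
    rw [Finset.sum_comm]
    refine Finset.sum_le_sum fun y _ => ?_
    by_cases hy : y = 0
    · simp [hy, hv0]
    · obtain ⟨i, hi⟩ := Function.ne_iff.1 hy
      refine le_trans ?_ (Finset.single_le_sum (fun j _ => ?_) (Finset.mem_univ i))
      · rw [if_pos (by simpa using hi)]
      · split_ifs <;> positivity
  have hterm : ∀ i, (∑ y : V → ZMod 2, if y i ≠ 0 then ‖v y‖ ^ 2 else 0) ≤
      ((cone Ls {i} ∩ M).card : ℝ) ^ 2 := by
    intro i
    set Q : Op V := diagonal fun y => if y i ≠ 0 then 1 else 0 with hQ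
    set T : Finset V := (cone Ls {i})ᶜ with hT
    have hQs : SupportedOn {i} Q := by
      have := supportedOn_extend {i}
        (diagonal fun y : ({i} : Finset V) → ZMod 2 => if y ⟨i, by simp⟩ ≠ 0 then (1 : ℂ) else 0)
      rwa [extend_diagonal] at this
    -- Freezing the bits in the cone of `i` at `0` gives an observable supported off the cone, at
    -- distance at most `|cone ∩ M|` from `f`.
    set f' : (V → ZMod 2) → ℝ := fun y => f fun j => if j ∈ T then y j else 0 with hf'
    set F' : Op V := diagonal fun y => (f' y : ℂ) with hF'
    have hF'e : F' = extend T (diagonal fun y : T → ZMod 2 =>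
        (f fun j => if h : j ∈ T then y ⟨j, h⟩ else 0 : ℂ)) := by
      rw [extend_diagonal]
      simp [hF', hf', dite_eq_ite]
    have hcomm : Commute (U * Q * Uᴴ) F' := by
      rw [hF'e]
      exact hQs.circuit_conj Ls T _ disjoint_compl_right
    -- `U Q Uᴴ` lives on the cone and commutes with `F'`, so `Q` can be moved onto `|0…0⟩`, which it
    -- annihilates. Only `F - F'` then contributes where `y i ≠ 0`.
    have hzero : Q *ᵥ (Uᴴ *ᵥ (F' *ᵥ φ)) = 0 := by
      have hQ0 : Q *ᵥ Pi.single 0 1 = 0 := by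
        funext y
        rw [hQ, mulVec_diagonal]
        by_cases hy : y = 0 <;> simp [hy]
      have : Q * Uᴴ * F' * U = Uᴴ * F' * U * Q := by
        calc Q * Uᴴ * F' * U = (Uᴴ * U) * Q * Uᴴ * F' * U := by rw [hUU, one_mul]
          _ = Uᴴ * ((U * Q * Uᴴ) * F') * U := by simp only [mul_assoc]
          _ = Uᴴ * (F' * (U * Q * Uᴴ)) * U := by rw [hcomm.eq]
          _ = Uᴴ * F' * U * Q * (Uᴴ * U) := by simp only [mul_assoc]
          _ = _ := by rw [hUU, mul_one]
      rw [hφ, mulVec_mulVec, mulVec_mulVec, mulVec_mulVec, this,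
        ← mulVec_mulVec, hQ0, mulVec_zero]
    set w : (V → ZMod 2) → ℂ := Uᴴ *ᵥ ((F - F') *ᵥ φ) with hw
    have hvw : ∀ y : V → ZMod 2, y i ≠ 0 → v y = w y := by
      intro y hy
      have h1 := congrFun hzero y
      rw [hQ, mulVec_diagonal, if_pos hy, one_mul] at h1
      rw [hw, sub_mulVec, mulVec_sub, Pi.sub_apply, h1, Pi.zero_apply, sub_zero]
    calc (∑ y : V → ZMod 2, if y i ≠ 0 then ‖v y‖ ^ 2 else 0)
        ≤ ∑ y, ‖w y‖ ^ 2 := by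
          refine Finset.sum_le_sum fun y _ => ?_
          split_ifs with hy
          · rw [hvw y hy]
          · positivity
      _ = ∑ y, ‖((F - F') *ᵥ φ) y‖ ^ 2 := sum_norm_sq_mulVec hU' _
      _ ≤ ∑ y, ((cone Ls {i} ∩ M).card : ℝ) ^ 2 * ‖φ y‖ ^ 2 := by
          refine Finset.sum_le_sum fun y _ => ?_
          rw [hF, hF', diagonal_sub, mulVec_diagonal, norm_mul, mul_pow, ← Complex.ofReal_sub,
            Complex.norm_real, Real.norm_eq_abs]
          have : |f y - f' y| ≤ ((cone Ls {i} ∩ M).card : ℝ) := by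
            refine (hf _ _).trans ?_
            refine Nat.cast_le.2 (Finset.card_le_card fun j hj => ?_)
            simp only [Finset.mem_filter, hT, Finset.mem_compl] at hj
            refine Finset.mem_inter.2 ⟨?_, hj.1⟩
            by_contra hjc
            exact hj.2 (by simp [hjc])
          gcongr
      _ = _ := by rw [← Finset.mul_sum, hφ1, mul_one]
  rw [← hnv]
  refine (hcut.trans (Finset.sum_le_sum fun i _ => hterm i)).trans ?_
  exact_mod_cast sum_card_cone_inter_sq_le Ls M

end Extend

/-! ### Pauli operators -/

/-- The sign `(-1)^r`. -/
def sign (r : ZMod 2) : ℝ := if r = 0 then 1 else -1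

theorem sign_zero : sign 0 = 1 := rfl

theorem sign_one : sign 1 = -1 := if_neg (by decide)

theorem zmod_two_cases (r : ZMod 2) : r = 0 ∨ r = 1 := by
  revert r; decide

theorem sum_zmod_two {M : Type} [AddCommMonoid M] (f : ZMod 2 → M) : ∑ r, f r = f 0 + f 1 :=
  Fin.sum_univ_two f

theorem sign_add (r s : ZMod 2) : sign (r + s) = sign r * sign s := by
  rcases zmod_two_cases r with rfl | rfl <;> rcases zmod_two_cases s with rfl | rfl <;>
    simp [sign_zero, sign_one, show (1 : ZMod 2) + 1 = 0 from rfl]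

theorem sign_mul_self (r : ZMod 2) : sign r * sign r = 1 := by
  rcases zmod_two_cases r with rfl | rfl <;> simp [sign_zero, sign_one]

theorem sign_sum {ι : Type} (s : Finset ι) (f : ι → ZMod 2) :
    sign (∑ i ∈ s, f i) = ∏ i ∈ s, sign (f i) := by
  classical
  induction s using Finset.induction_on with
  | empty => simp [sign_zero]
  | insert a s ha ih => rw [Finset.sum_insert ha, Finset.prod_insert ha, sign_add, ih]

theorem pauliZ_eq : pauliZ = diagonal fun r => (sign r : ℂ) := by
  unfold pauliZ sign
  congr 1
  funext r
  split_ifs <;> simp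

/-! ### Tensor products of one-qubit operators -/

section Tensor

variable {Q : Type} [Fintype Q]

theorem tensor_mul [DecidableEq Q] (A B : Q → Matrix (ZMod 2) (ZMod 2) ℂ) :
    tensor A * tensor B = tensor fun i => A i * B i := by
  ext r c
  simp only [tensor, mul_apply, of_apply, ← Finset.prod_mul_distrib]
  rw [Finset.prod_univ_sum, Fintype.piFinset_univ]

theorem tensor_one : tensor (fun _ : Q => (1 : Matrix (ZMod 2) (ZMod 2) ℂ)) = 1 := by
  ext r c
  simp only [tensor, of_apply, one_apply]
  by_cases h : r = c
  · simp [h]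
  · obtain ⟨i, hi⟩ := Function.ne_iff.1 h
    rw [if_neg h]
    exact Finset.prod_eq_zero (Finset.mem_univ i) (if_neg hi)

theorem tensor_conjTranspose (A : Q → Matrix (ZMod 2) (ZMod 2) ℂ) :
    (tensor A)ᴴ = tensor fun i => (A i)ᴴ := by
  ext r c
  simp [tensor, conjTranspose_apply]

theorem extend_tensor [DecidableEq Q] (S : Finset Q) (A : Q → Matrix (ZMod 2) (ZMod 2) ℂ)
    (hA : ∀ i, i ∉ S → A i = 1) : extend S (tensor fun i : S => A i) = tensor A := by
  ext r c
  simp only [extend, tensor, of_apply]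
  split_ifs with h
  · rw [Finset.prod_coe_sort S fun i => A i (r i) (c i)]
    refine Finset.prod_subset (Finset.subset_univ S) fun i _ hi => ?_
    rw [hA i hi, h i hi, one_apply_eq]
  · push Not at h
    obtain ⟨i, hi, hrc⟩ := h
    exact (Finset.prod_eq_zero (Finset.mem_univ i) (by rw [hA i hi, one_apply_ne hrc])).symm

theorem pauliX_mul_self : pauliX * pauliX = 1 := by
  ext r c
  rw [mul_apply, sum_zmod_two]
  rcases zmod_two_cases r with rfl | rfl <;> rcases zmod_two_cases c with rfl | rfl <;>
    simp [pauliX]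

theorem pauliZ_mul_self : pauliZ * pauliZ = 1 := by
  rw [pauliZ_eq, diagonal_mul_diagonal, ← diagonal_one]
  congr 1
  funext r
  exact_mod_cast sign_mul_self r

theorem pauliX_conjTranspose : pauliXᴴ = pauliX := by
  ext r c
  simp [pauliX, conjTranspose_apply, eq_comm, apply_ite]

theorem pauliZ_conjTranspose : pauliZᴴ = pauliZ := by
  rw [pauliZ_eq, diagonal_conjTranspose]
  congr 1
  funext r
  simp

theorem tensor_pow_mul_self [DecidableEq Q] {A : Matrix (ZMod 2) (ZMod 2) ℂ} (hA : A * A = 1) (e : Q → ZMod 2) :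
    tensor (fun i => if e i = 1 then A else 1) * tensor (fun i => if e i = 1 then A else 1) =
      1 := by
  rw [tensor_mul, ← tensor_one]
  congr 1
  funext i
  split_ifs <;> simp [hA]

theorem tensor_pow_conjTranspose {A : Matrix (ZMod 2) (ZMod 2) ℂ} (hA : Aᴴ = A) (e : Q → ZMod 2) :
    (tensor fun i => if e i = 1 then A else 1)ᴴ = tensor fun i => if e i = 1 then A else 1 := by
  rw [tensor_conjTranspose]
  congr 1
  funext i
  split_ifs <;> simp [hA]

theorem xPauli_apply (e r c : Q → ZMod 2) : xPauli e r c = if c = r + e then 1 else 0 := by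
  have key : ∀ i, (if e i = 1 then pauliX else (1 : Matrix (ZMod 2) (ZMod 2) ℂ)) (r i) (c i) =
      if c i = r i + e i then 1 else 0 := by
    intro i
    generalize e i = a
    generalize r i = b
    generalize c i = d
    rcases zmod_two_cases a with rfl | rfl <;> rcases zmod_two_cases b with rfl | rfl <;>
      rcases zmod_two_cases d with rfl | rfl <;>
      simp [pauliX, show (1 : ZMod 2) + 1 = 0 from rfl]
  simp only [xPauli, tensor, of_apply]
  rw [Finset.prod_congr rfl fun i _ => key i, Finset.prod_ite_zero]
  simp [funext_iff]

theorem zPauli_eq (e : Q → ZMod 2) : zPauli e = diagonal fun r => (sign (e ⬝ᵥ r) : ℂ) := by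
  ext r c
  simp only [zPauli, tensor, of_apply, diagonal_apply]
  split_ifs with h
  · subst h
    rw [dotProduct, sign_sum, Complex.ofReal_prod]
    refine Finset.prod_congr rfl fun i _ => ?_
    rcases zmod_two_cases (e i) with h | h <;> simp [h, pauliZ_eq, sign_zero]
  · obtain ⟨i, hi⟩ := Function.ne_iff.1 h
    refine Finset.prod_eq_zero (Finset.mem_univ i) ?_
    split_ifs <;> simp [pauliZ_eq, hi]

/-! ### Locality -/

variable [DecidableEq Q]

theorem posSemidef_half_one_sub {ι : Type} [Fintype ι] [DecidableEq ι] {A : Matrix ι ι ℂ}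
    (hA : Aᴴ = A) (hA2 : A * A = 1) : ((1 / 2 : ℂ) • (1 - A)).PosSemidef := by
  have h : (1 / 2 : ℂ) • (1 - A) = ((1 / 2 : ℂ) • (1 - A))ᴴ * ((1 / 2 : ℂ) • (1 - A)) := by
    have h2 : (1 - A) * (1 - A) = (2 : ℂ) • (1 - A) := by
      rw [sub_mul, mul_sub, mul_sub, hA2, two_smul]
      simp only [mul_one, one_mul]
      abel
    rw [conjTranspose_smul, conjTranspose_sub, hA, conjTranspose_one, smul_mul_smul, h2, smul_smul]
    congr 1
    simp
  rw [h]
  exact posSemidef_conjTranspose_mul_self _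

/-- A term of a `k`-local Hamiltonian. -/
def IsLocalTerm (k : ℕ) (T : Op Q) : Prop :=
  T.PosSemidef ∧ (1 - T).PosSemidef ∧
    ∃ (S : Finset Q) (h : Op S), S.card ≤ k ∧ h.PosSemidef ∧ T = extend S h

theorem isLocalTerm_half_one_sub {A : Matrix (ZMod 2) (ZMod 2) ℂ} (hA : Aᴴ = A)
    (hA2 : A * A = 1) {k : ℕ} {e : Q → ZMod 2} (he : hammingNorm e ≤ k) :
    IsLocalTerm k ((1 / 2 : ℂ) • (1 - tensor fun i => if e i = 1 then A else 1)) := by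
  set S : Finset Q := Finset.univ.filter fun i => e i ≠ 0 with hS
  refine ⟨posSemidef_half_one_sub (tensor_pow_conjTranspose hA e) (tensor_pow_mul_self hA2 e), ?_,
    S, (1 / 2 : ℂ) • (1 - tensor fun i : S => if e i = 1 then A else 1), he,
    posSemidef_half_one_sub (tensor_pow_conjTranspose hA fun i : S => e i)
      (tensor_pow_mul_self hA2 fun i : S => e i), ?_⟩
  · set B := tensor fun i => if e i = 1 then A else 1 with hB
    -- The complementary projection has the same form, with the involution `-B`.
    have h : 1 - (1 / 2 : ℂ) • (1 - B) = (1 / 2 : ℂ) • (1 - -B) := by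
      ext r c
      simp only [Matrix.sub_apply, Matrix.smul_apply, Matrix.neg_apply, smul_eq_mul]
      ring
    rw [h]
    refine posSemidef_half_one_sub ?_ ?_
    · rw [conjTranspose_neg, tensor_pow_conjTranspose hA e]
    · rw [neg_mul_neg, tensor_pow_mul_self hA2 e]
  · rw [extend_smul, extend_sub, extend_one,
      extend_tensor S fun i => if e i = 1 then A else 1]
    intro i hi
    rw [if_neg]
    intro h
    simp [hS, h] at hi

theorem isLocalTerm_zero (k : ℕ) : IsLocalTerm k (0 : Op Q) := by
  refine ⟨.zero, ?_, ∅, 0, by simp, .zero, ?_⟩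
  · rw [sub_zero]; exact .one
  · ext r c; simp [extend]

theorem isLocalHamiltonian_of_fintype {ι : Type} [Fintype ι] [Nonempty ι] {k : ℕ} (T : ι → Op Q)
    (hT : ∀ i, IsLocalTerm k (T i)) :
    IsLocalHamiltonian k ((1 / (Fintype.card ι : ℂ)) • ∑ i, T i) := by
  refine ⟨Fintype.card ι, T ∘ (Fintype.equivFin ι).symm, Fintype.card_pos, ?_, fun i => hT _⟩
  congr 1
  exact ((Fintype.equivFin ι).symm.sum_comp T).symm

theorem isLocalHamiltonian_average {k m : ℕ} (T : Fin m → Op Q)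
    (hT : ∀ i, IsLocalTerm k (T i)) :
    IsLocalHamiltonian k ((1 / (m : ℂ)) • ∑ i, T i) := by
  rcases m.eq_zero_or_pos with rfl | hm
  -- An empty group of checks gives `0`, written as one zero term because locality asks for a
  -- positive number of terms.
  · convert isLocalHamiltonian_of_fintype (ι := Unit) (fun _ => (0 : Op Q))
      (fun _ => isLocalTerm_zero k) using 1
    simp
  · exact ⟨m, T, hm, rfl, hT⟩

/-- Repeating each term over `Fin m₁ × Fin m₂` turns both averages into averages of the same length.
-/
theorem IsLocalHamiltonian.half_add {k : ℕ} {H₁ H₂ : Op Q} (h₁ : IsLocalHamiltonian k H₁)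
    (h₂ : IsLocalHamiltonian k H₂) : IsLocalHamiltonian k ((1 / 2 : ℂ) • (H₁ + H₂)) := by
  obtain ⟨m₁, T₁, hm₁, rfl, hT₁⟩ := h₁
  obtain ⟨m₂, T₂, hm₂, rfl, hT₂⟩ := h₂
  have : Nonempty (Fin m₁ × Fin m₂ ⊕ Fin m₁ × Fin m₂) := ⟨Sum.inl (⟨0, hm₁⟩, ⟨0, hm₂⟩)⟩
  have h1 : (m₁ : ℂ) ≠ 0 := Nat.cast_ne_zero.2 hm₁.ne'
  have h2 : (m₂ : ℂ) ≠ 0 := Nat.cast_ne_zero.2 hm₂.ne'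
  convert isLocalHamiltonian_of_fintype (k := k)
    (Sum.elim (fun p : Fin m₁ × Fin m₂ => T₁ p.1) fun p : Fin m₁ × Fin m₂ => T₂ p.2)
    (Sum.rec (fun p => hT₁ p.1) fun p => hT₂ p.2) using 1
  simp only [Fintype.sum_sum_type, Sum.elim_inl, Sum.elim_inr, Fintype.sum_prod_type,
    Finset.sum_const, Finset.card_univ, Fintype.card_sum, Fintype.card_prod, Fintype.card_fin,
    ← Finset.smul_sum, ← Nat.cast_smul_eq_nsmul ℂ, smul_add, smul_smul]
  push_cast
  congr 2 <;> field_simp <;> norm_num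

end Tensor

namespace ThreeTermComplex

variable (C : ThreeTermComplex)

theorem hamiltonian_eq : C.hamiltonian =
    (1 / 2 : ℂ) • ((1 / (C.n0 : ℂ)) • ∑ i, (1 / 2 : ℂ) • (1 - xPauli (C.xCheck i)) +
      (1 / (C.n2 : ℂ)) • ∑ j, (1 / 2 : ℂ) • (1 - zPauli (C.zCheck j))) := by
  rw [hamiltonian, smul_add, smul_smul, smul_smul]
  congr 2 <;> rw [one_div_mul_one_div]

theorem isLocalHamiltonian_hamiltonian {q : ℕ} (h : C.HasCheckWeightAtMost q) :
    IsLocalHamiltonian q C.hamiltonian := by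
  rw [hamiltonian_eq]
  exact (isLocalHamiltonian_average _ fun i =>
      isLocalTerm_half_one_sub pauliX_conjTranspose pauliX_mul_self (h.1 i)).half_add
    (isLocalHamiltonian_average _ fun j =>
      isLocalTerm_half_one_sub pauliZ_conjTranspose pauliZ_mul_self (h.2 j))

/-! ### The ground state -/

theorem xCheck_dotProduct (i : Fin C.n0) (x : Fin C.n1 → ZMod 2) :
    C.xCheck i ⬝ᵥ x = (C.bd1 *ᵥ x) i := by
  rw [xCheck, mulVec_transpose, ← dotProduct_mulVec, single_dotProduct, one_mul]

theorem zCheck_dotProduct (j : Fin C.n2) (x : Fin C.n1 → ZMod 2) :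
    C.zCheck j ⬝ᵥ x = (C.bd2ᵀ *ᵥ x) j := by
  rw [zCheck, ← vecMul_transpose, ← dotProduct_mulVec, single_dotProduct, one_mul]

theorem bd2_transpose_mulVec_bd1_transpose (w : Fin C.n0 → ZMod 2) :
    C.bd2ᵀ *ᵥ (C.bd1ᵀ *ᵥ w) = 0 := by
  rw [mulVec_mulVec, ← transpose_mul, C.bd_comp, transpose_zero, zero_mulVec]

/-- The indicator of `im ∂₁ᵀ` is a ground vector: `X` checks translate within this subspace, and `Z`
checks act on it trivially since `∂₂ᵀ ∂₁ᵀ = 0`. -/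
theorem zero_mem_spectrum_hamiltonian : (0 : ℝ) ∈ spectrum ℝ C.hamiltonian := by
  classical
  rw [spectrum.zero_mem_iff]
  intro hunit
  set R := LinearMap.range C.bd1ᵀ.mulVecLin with hR
  set v : (Fin C.n1 → ZMod 2) → ℂ := fun x => if x ∈ R then 1 else 0 with hv
  have hx : ∀ i, xPauli (C.xCheck i) *ᵥ v = v := by
    intro i
    have hi : C.xCheck i ∈ R := ⟨_, rfl⟩
    funext r
    simp only [mulVec, dotProduct, xPauli_apply, ite_mul, one_mul, zero_mul, Finset.sum_ite_eq',
      Finset.mem_univ, if_true, hv, R.add_mem_iff_left hi]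
  have hz : ∀ j, zPauli (C.zCheck j) *ᵥ v = v := by
    intro j
    funext r
    rw [zPauli_eq, mulVec_diagonal, zCheck_dotProduct]
    by_cases hr : r ∈ R
    · obtain ⟨w, rfl⟩ := hr
      rw [mulVecLin_apply, bd2_transpose_mulVec_bd1_transpose]
      simp [sign_zero]
    · simp [hv, hr]
  have hH : C.hamiltonian *ᵥ v = 0 := by
    simp only [hamiltonian, add_mulVec, smul_mulVec, sum_mulVec, sub_mulVec, one_mulVec, hx, hz,
      sub_self, smul_zero, Finset.sum_const_zero, add_zero]
  have hv0 : v = 0 := by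
    rw [← mulVec_injective_of_isUnit hunit |>.eq_iff, hH, mulVec_zero]
  have := congrFun hv0 0
  simp [hv] at this

theorem lambdaMin_hamiltonian_nonpos : lambdaMin C.hamiltonian ≤ 0 :=
  csInf_le C.hamiltonian.finite_real_spectrum.bddBelow C.zero_mem_spectrum_hamiltonian

end ThreeTermComplex

/-! ### The Walsh–Hadamard transform -/

/-- The Hadamard gate. -/
noncomputable def hadamard : Matrix (ZMod 2) (ZMod 2) ℂ :=
  Matrix.of fun r c => (((√2)⁻¹ * sign (r * c) : ℝ) : ℂ)

theorem hadamard_conjTranspose : hadamardᴴ = hadamard := by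
  ext r c
  simp only [hadamard, conjTranspose_apply, of_apply, RCLike.star_def, Complex.conj_ofReal,
    mul_comm r c]

/-- The cases `t = 1` and `t = sign` yield `hadamard_mul_self` and the exchange of `Z` with `X`. -/
theorem hadamard_conj_diagonal (t : ZMod 2 → ℝ) (r c : ZMod 2) :
    (hadamard * diagonal (fun i => (t i : ℂ)) * hadamard) r c =
      ((1 / 2 * (t 0 + sign (r + c) * t 1) : ℝ) : ℂ) := by
  have h2 : (√2)⁻¹ * (√2)⁻¹ = (1 / 2 : ℝ) := by
    rw [← mul_inv, Real.mul_self_sqrt (by norm_num)]; norm_num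
  rw [mul_apply, sum_zmod_two, mul_diagonal, mul_diagonal]
  simp only [hadamard, of_apply, ← Complex.ofReal_mul, ← Complex.ofReal_add, mul_zero, zero_mul,
    mul_one, one_mul, sign_zero, sign_add]
  congr 1
  linear_combination (t 0 + sign r * sign c * t 1) * h2

theorem hadamard_mul_self : hadamard * hadamard = 1 := by
  have h := hadamard_conj_diagonal fun _ => 1
  simp only [Complex.ofReal_one, diagonal_one, mul_one] at h
  ext r c
  rw [h]
  rcases zmod_two_cases r with rfl | rfl <;> rcases zmod_two_cases c with rfl | rfl <;>
    simp [sign_zero, sign_one, show (1 : ZMod 2) + 1 = 0 from rfl] <;> norm_num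

theorem hadamard_mul_pauliZ_mul_hadamard : hadamard * pauliZ * hadamard = pauliX := by
  ext r c
  rw [pauliZ_eq, hadamard_conj_diagonal]
  rcases zmod_two_cases r with rfl | rfl <;> rcases zmod_two_cases c with rfl | rfl <;>
    simp [sign_zero, sign_one, pauliX, show (1 : ZMod 2) + 1 = 0 from rfl] <;> norm_num

section Walsh

variable (Q : Type) [Fintype Q] [DecidableEq Q]

/-- The tensor product of Hadamard gates on all qubits. -/
noncomputable def walsh : Op Q := tensor fun _ => hadamard

theorem walsh_mul_self : walsh Q * walsh Q = 1 := by
  rw [walsh, tensor_mul, ← tensor_one]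
  simp only [hadamard_mul_self]

omit [DecidableEq Q] in
theorem walsh_conjTranspose : (walsh Q)ᴴ = walsh Q := by
  rw [walsh, tensor_conjTranspose]
  simp only [hadamard_conjTranspose]

theorem walsh_mem_unitaryGroup : walsh Q ∈ unitaryGroup (Q → ZMod 2) ℂ := by
  rw [mem_unitaryGroup_iff, star_eq_conjTranspose, walsh_conjTranspose, walsh_mul_self]

variable {Q}

omit [DecidableEq Q] in
theorem walsh_apply (x y : Q → ZMod 2) :
    walsh Q x y = (((√2)⁻¹ ^ Fintype.card Q * sign (x ⬝ᵥ y) : ℝ) : ℂ) := by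
  simp only [walsh, tensor, hadamard, of_apply]
  rw [← Complex.ofReal_prod, Finset.prod_mul_distrib, dotProduct, sign_sum]
  simp

theorem xPauli_eq (e : Q → ZMod 2) : xPauli e = walsh Q * zPauli e * walsh Q := by
  rw [walsh, zPauli, tensor_mul, tensor_mul, xPauli]
  congr 1
  funext i
  split_ifs
  · rw [hadamard_mul_pauliZ_mul_hadamard]
  · rw [mul_one, hadamard_mul_self]

variable (Q) in
/-- The layer of Hadamard gates on the qubits of `Q`, in the presence of ancillas. -/
noncomputable def hadamardLayer (A : Type) [Fintype A] [DecidableEq A] : BlockLayer (Q ⊕ A) where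
  blocks := Finset.univ.image fun j : Q => {Sum.inl j}
  card_le p hp := by
    obtain ⟨j, -, rfl⟩ := Finset.mem_image.1 hp
    simp
  disjoint_blocks p hp p' hp' h := by
    obtain ⟨j, -, rfl⟩ := Finset.mem_image.1 hp
    obtain ⟨j', -, rfl⟩ := Finset.mem_image.1 hp'
    rw [Finset.disjoint_singleton]
    exact fun he => h (by rw [he])
  gate p := walsh p
  gate_unitary p _ := walsh_mem_unitaryGroup p

/-! ### Expectation values in the reduced state -/

variable {A : Type} [Fintype A] [DecidableEq A]

/-- The component of `φ` at the ancilla configuration `a`. -/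
def slice (φ : (Q ⊕ A → ZMod 2) → ℂ) (a : A → ZMod 2) : (Q → ZMod 2) → ℂ :=
  fun x => φ (Sum.elim x a)

theorem sum_sum_elim {M : Type} [AddCommMonoid M] (f : (Q ⊕ A → ZMod 2) → M) :
    ∑ y, f y = ∑ x, ∑ a, f (Sum.elim x a) := by
  rw [← (Equiv.sumArrowEquivProdArrow Q A (ZMod 2)).symm.sum_comp, Fintype.sum_prod_type]
  rfl

theorem hadamardLayer_toOp_apply (x y : Q → ZMod 2) (a b : A → ZMod 2) :
    (hadamardLayer Q A).toOp (Sum.elim x a) (Sum.elim y b) = if a = b then walsh Q x y else 0 := by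
  have hinj : Function.Injective fun j : Q => ({Sum.inl j} : Finset (Q ⊕ A)) :=
    fun j j' h => Sum.inl_injective (Finset.singleton_injective h)
  simp only [BlockLayer.toOp, blockOp, hadamardLayer, of_apply]
  rw [Finset.prod_image fun j _ j' _ h => hinj h]
  congr 1
  · simp [funext_iff]
  · rw [walsh, tensor, of_apply]
    refine Finset.prod_congr rfl fun j _ => ?_
    rw [walsh, tensor, of_apply, Finset.prod_coe_sort {Sum.inl j}
      fun i : Q ⊕ A => hadamard (Sum.elim x a i) (Sum.elim y b i), Finset.prod_singleton]
    rfl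

theorem slice_hadamardLayer (φ : (Q ⊕ A → ZMod 2) → ℂ) (a : A → ZMod 2) :
    slice ((hadamardLayer Q A).toOp *ᵥ φ) a = walsh Q *ᵥ slice φ a := by
  funext x
  simp only [slice, mulVec, dotProduct, sum_sum_elim, hadamardLayer_toOp_apply, ite_mul, zero_mul,
    Finset.sum_ite_eq, Finset.mem_univ, if_true]

/-- The expectation of an operator on `Q` in the (pure) state `φ` of `Q` and the ancillas. -/
def expect (φ : (Q ⊕ A → ZMod 2) → ℂ) (M : Op Q) : ℂ :=
  ∑ a, star (slice φ a) ⬝ᵥ (M *ᵥ slice φ a)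

theorem trace_partialTrace_mul (φ : (Q ⊕ A → ZMod 2) → ℂ) (M : Op Q) :
    (partialTrace (vecMulVec φ (star φ)) * M).trace = expect φ M := by
  simp only [trace, diag_apply, mul_apply, partialTrace, of_apply, vecMulVec_apply, expect,
    dotProduct, mulVec, slice, Pi.star_apply, Finset.sum_mul, Finset.mul_sum]
  rw [Finset.sum_comm]
  rw [Finset.sum_congr rfl fun y _ => Finset.sum_comm, Finset.sum_comm]
  refine Finset.sum_congr rfl fun a _ => Finset.sum_congr rfl fun y _ =>
    Finset.sum_congr rfl fun x _ => ?_
  ring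

theorem expect_add (φ : (Q ⊕ A → ZMod 2) → ℂ) (M N : Op Q) :
    expect φ (M + N) = expect φ M + expect φ N := by
  simp only [expect, add_mulVec, dotProduct_add, Finset.sum_add_distrib]

theorem expect_smul (φ : (Q ⊕ A → ZMod 2) → ℂ) (z : ℂ) (M : Op Q) :
    expect φ (z • M) = z * expect φ M := by
  simp only [expect, smul_mulVec, dotProduct_smul, smul_eq_mul, Finset.mul_sum]

/-- Testing in the `X` basis costs just one more circuit layer. -/
theorem expect_walsh_conj (φ : (Q ⊕ A → ZMod 2) → ℂ) (M : Op Q) :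
    expect φ (walsh Q * M * walsh Q) = expect ((hadamardLayer Q A).toOp *ᵥ φ) M := by
  simp only [expect, slice_hadamardLayer]
  refine Finset.sum_congr rfl fun a _ => ?_
  rw [star_mulVec, walsh_conjTranspose, ← dotProduct_mulVec, mulVec_mulVec, mulVec_mulVec,
    mul_assoc]

theorem expect_conjTranspose_mul_self_nonneg (φ : (Q ⊕ A → ZMod 2) → ℂ) (K : Op Q) :
    0 ≤ (expect φ (Kᴴ * K)).re := by
  rw [expect, Complex.re_sum]
  refine Finset.sum_nonneg fun a _ => ?_
  have : star (slice φ a) ⬝ᵥ ((Kᴴ * K) *ᵥ slice φ a) =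
      star (K *ᵥ slice φ a) ⬝ᵥ (K *ᵥ slice φ a) := by
    rw [star_mulVec, ← dotProduct_mulVec, mulVec_mulVec]
  rw [this, dotProduct_star_self_eq, Complex.ofReal_re]
  positivity

/-- The distribution of the outcomes on `Q` in the computational basis. -/
noncomputable def marginal (φ : (Q ⊕ A → ZMod 2) → ℂ) (x : Q → ZMod 2) : ℝ :=
  ∑ a, ‖φ (Sum.elim x a)‖ ^ 2

omit [Fintype Q] [DecidableEq Q] in
theorem marginal_nonneg (φ : (Q ⊕ A → ZMod 2) → ℂ) (x : Q → ZMod 2) : 0 ≤ marginal φ x :=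
  Finset.sum_nonneg fun _ _ => by positivity

theorem sum_marginal_mul (φ : (Q ⊕ A → ZMod 2) → ℂ) (h : (Q → ZMod 2) → ℝ) :
    ∑ x, marginal φ x * h x = ∑ y, ‖φ y‖ ^ 2 * h fun i => y (Sum.inl i) := by
  rw [sum_sum_elim]
  simp only [marginal, Finset.sum_mul, Sum.elim_inl]

theorem expect_diagonal (φ : (Q ⊕ A → ZMod 2) → ℂ) (t : (Q → ZMod 2) → ℝ) :
    expect φ (diagonal fun x => (t x : ℂ)) = ((∑ x, marginal φ x * t x : ℝ) : ℂ) := by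
  simp only [expect, marginal, Finset.sum_mul, Complex.ofReal_sum, dotProduct, mulVec_diagonal]
  rw [Finset.sum_comm]
  refine Finset.sum_congr rfl fun x _ => Finset.sum_congr rfl fun a _ => ?_
  rw [Pi.star_apply, slice, Complex.ofReal_mul, Complex.ofReal_pow, ← Complex.conj_mul',
    RCLike.star_def]
  ring

theorem sum_marginal_circuit (Ls : List (BlockLayer (Q ⊕ A))) :
    ∑ x, marginal (blockCircuitOp Ls *ᵥ Pi.single 0 1) x = 1 := by
  have h := sum_marginal_mul (blockCircuitOp Ls *ᵥ Pi.single 0 1) fun _ : Q → ZMod 2 => 1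
  simpa only [mul_one, sum_norm_sq_circuit] using h

theorem sum_marginal_sq_le_of_lipschitz (Ls : List (BlockLayer (Q ⊕ A)))
    (h : (Q → ZMod 2) → ℝ) (hh : ∀ x y, |h x - h y| ≤ (hammingDist x y : ℝ))
    (hmean : ∑ x, marginal (blockCircuitOp Ls *ᵥ Pi.single 0 1) x * h x = 0) :
    ∑ x, marginal (blockCircuitOp Ls *ᵥ Pi.single 0 1) x * h x ^ 2 ≤
      4 ^ Ls.length * (Fintype.card Q : ℝ) := by
  rw [sum_marginal_mul] at hmean
  rw [sum_marginal_mul _ fun x => h x ^ 2]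
  have := sum_sq_le_of_lipschitz Ls (Finset.univ.image (Sum.inl : Q → Q ⊕ A))
    (fun y => h fun i => y (Sum.inl i)) (fun y y' => (hh _ _).trans (Nat.cast_le.2 ?_)) hmean
  · rwa [Finset.card_image_of_injective _ Sum.inl_injective, Finset.card_univ] at this
  · rw [Finset.filter_image, Finset.card_image_of_injective _ Sum.inl_injective]
    rfl

end Walsh

/-! ### The energy of a CSS Hamiltonian -/

/-- Each check penalises exactly the configurations that violate it. The case `c = 0` is covered by
`0 / 0 = 0`. -/
theorem average_zChecks {b c : ℕ} (g : Matrix (Fin c) (Fin b) (ZMod 2))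
    (e : Fin c → Fin b → ZMod 2) (he : ∀ i x, e i ⬝ᵥ x = (g *ᵥ x) i) :
    (1 / (c : ℂ)) • ∑ i, (1 / 2 : ℂ) • (1 - zPauli (e i)) =
      diagonal fun x => (((hammingNorm (g *ᵥ x) : ℝ) / c : ℝ) : ℂ) := by
  have hterm : ∀ i, (1 / 2 : ℂ) • (1 - zPauli (e i)) =
      diagonal fun x => if (g *ᵥ x) i ≠ 0 then (1 : ℂ) else 0 := by
    intro i
    rw [zPauli_eq, ← diagonal_one, diagonal_sub, ← diagonal_smul]
    congr 1
    funext x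
    rw [Pi.smul_apply, he]
    rcases zmod_two_cases ((g *ᵥ x) i) with h | h <;> simp [h, sign_zero, sign_one]
    norm_num
  simp only [hterm]
  ext x y
  rw [Matrix.smul_apply, Matrix.sum_apply]
  simp only [diagonal_apply]
  split_ifs
  · rw [Finset.sum_boole]
    simp only [hammingNorm]
    push_cast
    rw [smul_eq_mul]
    ring
  · simp

namespace ThreeTermComplex

variable (C : ThreeTermComplex)

theorem hamiltonian_eq_walsh : C.hamiltonian = (1 / 2 : ℂ) •
    (walsh _ * diagonal (fun x => (((hammingNorm (C.bd1 *ᵥ x) : ℝ) / C.n0 : ℝ) : ℂ)) * walsh _ +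
      diagonal fun x => (((hammingNorm (C.bd2ᵀ *ᵥ x) : ℝ) / C.n2 : ℝ) : ℂ)) := by
  rw [hamiltonian_eq, average_zChecks C.bd2ᵀ C.zCheck C.zCheck_dotProduct,
    ← average_zChecks C.bd1 C.xCheck C.xCheck_dotProduct]
  congr 2
  rw [mul_smul_comm, smul_mul_assoc, Finset.mul_sum, Finset.sum_mul]
  congr 1
  refine Finset.sum_congr rfl fun i _ => ?_
  rw [mul_smul_comm, smul_mul_assoc, mul_sub, sub_mul, mul_one, walsh_mul_self, xPauli_eq]

theorem re_expect_hamiltonian {A : Type} [Fintype A] [DecidableEq A]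
    (φ : (Fin C.n1 ⊕ A → ZMod 2) → ℂ) :
    (expect φ C.hamiltonian).re = 1 / 2 *
      (∑ x, marginal ((hadamardLayer _ A).toOp *ᵥ φ) x * ((hammingNorm (C.bd1 *ᵥ x) : ℝ) / C.n0) +
        ∑ x, marginal φ x * ((hammingNorm (C.bd2ᵀ *ᵥ x) : ℝ) / C.n2)) := by
  rw [hamiltonian_eq_walsh, expect_smul, expect_add, expect_walsh_conj, expect_diagonal,
    expect_diagonal, ← Complex.ofReal_add,
    show (1 / 2 : ℂ) = ((1 / 2 : ℝ) : ℂ) by push_cast; rfl, ← Complex.ofReal_mul, Complex.ofReal_re]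

/-! ### The uncertainty relation for decoded logical operators -/

/-- The entry of the conjugated `t` at `(x, y)` is a Fourier coefficient of `t` at `x + y`. As `t`
transforms by the character `b` under `ker ∂₁`, it vanishes unless `x + y + b ⊥ ker ∂₁`; then `x + y
∈ ker ∂₂ᵀ` and `a ⬝ (x + y) = a ⬝ b = 1`, so `s` changes sign from `x` to `y`. -/
theorem diagonal_anticommute_walsh_conj {a b : Fin C.n1 → ZMod 2} (ha : C.bd1 *ᵥ a = 0)
    (hb : C.bd2ᵀ *ᵥ b = 0) (hab : a ⬝ᵥ b = 1) {s t : (Fin C.n1 → ZMod 2) → ℝ}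
    (hs : ∀ x z, C.bd2ᵀ *ᵥ z = 0 → s (x + z) = sign (a ⬝ᵥ z) * s x)
    (ht : ∀ x z, C.bd1 *ᵥ z = 0 → t (x + z) = sign (b ⬝ᵥ z) * t x) :
    (walsh _ * diagonal (fun x => (t x : ℂ)) * walsh _) * diagonal (fun x => (s x : ℂ)) =
      -(diagonal (fun x => (s x : ℂ)) * (walsh _ * diagonal (fun x => (t x : ℂ)) * walsh _)) := by
  ext x y
  rw [Matrix.neg_apply, mul_diagonal, diagonal_mul]
  set B := walsh _ * diagonal (fun x => (t x : ℂ)) * walsh _ with hB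
  by_cases h0 : B x y = 0
  · simp [h0]
  have hBxy : B x y = ∑ w, walsh _ x w * (t w : ℂ) * walsh _ w y := by
    rw [hB, mul_apply]
    simp only [mul_diagonal]
  have hker : ∀ z, C.bd1 *ᵥ z = 0 → (x + y + b) ⬝ᵥ z = 0 := by
    intro z hz
    -- Shift the summation variable by `z`.
    have h1 : B x y = (sign ((x + y + b) ⬝ᵥ z) : ℂ) * B x y := by
      conv_lhs => rw [hBxy, ← Equiv.sum_comp (Equiv.addRight z)]
      rw [hBxy, Finset.mul_sum]
      refine Finset.sum_congr rfl fun w _ => ?_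
      simp only [Equiv.coe_addRight, walsh_apply, ht w z hz, ← Complex.ofReal_mul,
        add_dotProduct, dotProduct_add, sign_add, dotProduct_comm z y]
      congr 1
      ring
    rcases zmod_two_cases ((x + y + b) ⬝ᵥ z) with h | h
    · exact h
    · rw [h, sign_one] at h1
      refine absurd ?_ h0
      have h1 : B x y = -B x y := by simpa using h1
      exact self_eq_neg.1 h1
  have hcl : C.bd2ᵀ *ᵥ (x + y + b) = 0 := by
    funext j
    rw [← zCheck_dotProduct, dotProduct_comm, hker _ ?_, Pi.zero_apply]
    rw [zCheck, mulVec_mulVec, C.bd_comp, zero_mulVec]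
  have hxy : C.bd2ᵀ *ᵥ (x + y) = 0 := by rwa [mulVec_add, hb, add_zero] at hcl
  have haxy : a ⬝ᵥ (x + y) = 1 := by
    have h := hker a ha
    rw [add_dotProduct, dotProduct_comm b, hab, dotProduct_comm] at h
    rcases zmod_two_cases (a ⬝ᵥ (x + y)) with h' | h'
    · rw [h'] at h; exact absurd h (by decide)
    · exact h'
  have hy : x + (x + y) = y := by
    funext i
    simp only [Pi.add_apply, ← add_assoc, CharTwo.add_self_eq_zero, zero_add]
  have hsy : s y = -s x := by
    have := hs x (x + y) hxy
    rwa [hy, haxy, sign_one, neg_one_mul] at this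
  rw [hsy]
  push_cast
  ring

theorem sq_mean_add_sq_mean_le_one {A : Type} [Fintype A] [DecidableEq A]
    {φ : (Fin C.n1 ⊕ A → ZMod 2) → ℂ} (hφ : ∑ x, marginal φ x = 1)
    {a b : Fin C.n1 → ZMod 2} (ha : C.bd1 *ᵥ a = 0)
    (hb : C.bd2ᵀ *ᵥ b = 0) (hab : a ⬝ᵥ b = 1) {s t : (Fin C.n1 → ZMod 2) → ℝ}
    (hs : ∀ x z, C.bd2ᵀ *ᵥ z = 0 → s (x + z) = sign (a ⬝ᵥ z) * s x)
    (ht : ∀ x z, C.bd1 *ᵥ z = 0 → t (x + z) = sign (b ⬝ᵥ z) * t x)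
    (hs1 : ∀ x, s x * s x = 1) (ht1 : ∀ x, t x * t x = 1) :
    (∑ x, marginal φ x * s x) ^ 2 +
      (∑ x, marginal ((hadamardLayer _ A).toOp *ᵥ φ) x * t x) ^ 2 ≤ 1 := by
  set α := ∑ x, marginal φ x * s x with hα
  set β := ∑ x, marginal ((hadamardLayer _ A).toOp *ᵥ φ) x * t x with hβ
  set D : Op (Fin C.n1) := diagonal fun x => (s x : ℂ) with hD
  set T : Op (Fin C.n1) := diagonal fun x => (t x : ℂ) with hT
  set B : Op (Fin C.n1) := walsh _ * T * walsh _ with hB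
  have hDD : D * D = 1 := by
    rw [hD, diagonal_mul_diagonal, ← diagonal_one]
    congr 1; funext x; exact_mod_cast hs1 x
  have hTT : T * T = 1 := by
    rw [hT, diagonal_mul_diagonal, ← diagonal_one]
    congr 1; funext x; exact_mod_cast ht1 x
  have hBB : B * B = 1 := by
    calc B * B = walsh _ * T * (walsh _ * walsh _) * T * walsh _ := by
          rw [hB]; simp only [mul_assoc]
      _ = walsh _ * (T * T) * walsh _ := by rw [walsh_mul_self, mul_one]; simp only [mul_assoc]
      _ = 1 := by rw [hTT, mul_one, walsh_mul_self]
  have hDH : Dᴴ = D := by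
    rw [hD, diagonal_conjTranspose]; congr 1; funext x; simp
  have hTH : Tᴴ = T := by
    rw [hT, diagonal_conjTranspose]; congr 1; funext x; simp
  have hBH : Bᴴ = B := by
    rw [hB, conjTranspose_mul, conjTranspose_mul, hTH, walsh_conjTranspose, mul_assoc]
  have hBD : B * D = -(D * B) := C.diagonal_anticommute_walsh_conj ha hb hab hs ht
  have eD : expect φ D = (α : ℂ) := expect_diagonal φ s
  have eB : expect φ B = (β : ℂ) := by rw [hB, expect_walsh_conj]; exact expect_diagonal _ t
  have e1 : expect φ 1 = 1 := by
    have := expect_diagonal φ fun _ => 1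
    simpa [hφ] using this
  -- Anticommutation kills the cross terms of `K²`, whose expectation is therefore `1 - (α² + β²)`.
  set K : Op (Fin C.n1) := (α : ℂ) • D + (β : ℂ) • B + (-1 : ℂ) • 1 with hK
  have hKH : Kᴴ = K := by
    rw [hK]
    simp [conjTranspose_add, conjTranspose_smul, hDH, hBH]
  have hKK : Kᴴ * K = ((α : ℂ) ^ 2 + (β : ℂ) ^ 2 + 1) • (1 : Op (Fin C.n1)) +
      (-2 * α : ℂ) • D + (-2 * β : ℂ) • B := by
    rw [hKH, hK]
    simp only [add_mul, mul_add, smul_mul_smul, hDD, hBB, hBD, mul_one, one_mul]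
    module
  have hpos := expect_conjTranspose_mul_self_nonneg φ K
  rw [hKK, expect_add, expect_add, expect_smul, expect_smul, expect_smul, e1, eD, eB] at hpos
  have : (((α : ℂ) ^ 2 + (β : ℂ) ^ 2 + 1) * 1 + (-2 * α) * α + (-2 * β) * β : ℂ) =
      ((1 - (α ^ 2 + β ^ 2) : ℝ) : ℂ) := by
    push_cast; ring
  rw [this, Complex.ofReal_re] at hpos
  linarith

end ThreeTermComplex

/-! ### Concentration of shallow distributions against expansion -/

/-- Minimum weight coset representatives. -/
theorem exists_coset_leader {b : ℕ} (Z : Submodule (ZMod 2) (Fin b → ZMod 2)) :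
    ∃ e : (Fin b → ZMod 2) → Fin b → ZMod 2, (∀ x, x + e x ∈ Z) ∧
      (∀ x, ∀ z ∈ Z, e (x + z) = e x) ∧ ∀ x, hammingNorm (e x) ≤ distTo x Z := by
  have h : ∀ q : (Fin b → ZMod 2) ⧸ Z, ∃ v, Submodule.Quotient.mk v = q ∧
      ∀ w, Submodule.Quotient.mk w = q → hammingNorm v ≤ hammingNorm w := fun q =>
    Set.exists_min_image {v | Submodule.Quotient.mk v = q} hammingNorm (Set.toFinite _)
      (Submodule.Quotient.mk_surjective Z q)
  choose r hr hmin using h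
  refine ⟨fun x => r (Submodule.Quotient.mk x), fun x => ?_, fun x z hz => ?_, fun x => ?_⟩
  · have := (Submodule.Quotient.eq Z).1 (hr (Submodule.Quotient.mk x))
    rw [add_comm]
    convert this using 1
    funext i
    simp only [Pi.add_apply, Pi.sub_apply, CharTwo.sub_eq_add]
  · refine congrArg r ((Submodule.Quotient.eq Z).2 ?_)
    simpa using hz
  · refine le_ciInf fun z => hmin _ _ ?_
    rw [Submodule.Quotient.eq]
    simp

theorem distTo_eq_zero {b : ℕ} {Z : Submodule (ZMod 2) (Fin b → ZMod 2)} {x : Fin b → ZMod 2}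
    (hx : x ∈ Z) : distTo x Z = 0 := by
  refine Nat.eq_zero_of_le_zero ((ciInf_le (OrderBot.bddBelow _) ⟨-x, Z.neg_mem hx⟩).trans ?_)
  simp

theorem hammingDist_eq_hammingNorm_sub {b : ℕ} (x y : Fin b → ZMod 2) :
    hammingDist x y = hammingNorm (x - y) := by
  rw [hammingDist_comm, hammingDist_eq_hammingNorm, neg_add_eq_sub]

theorem abs_inf'_hammingDist_sub_le {b : ℕ} {S : Finset (Fin b → ZMod 2)} (hS : S.Nonempty)
    (x y : Fin b → ZMod 2) :
    |S.inf' hS (fun z => (hammingDist x z : ℝ)) - S.inf' hS (fun z => (hammingDist y z : ℝ))| ≤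
      (hammingDist x y : ℝ) := by
  have key : ∀ x y : Fin b → ZMod 2, S.inf' hS (fun z => (hammingDist x z : ℝ)) -
      S.inf' hS (fun z => (hammingDist y z : ℝ)) ≤ hammingDist x y := by
    intro x y
    obtain ⟨z, hz, he⟩ := S.exists_mem_eq_inf' hS fun z => (hammingDist y z : ℝ)
    rw [he, sub_le_iff_le_add]
    exact (Finset.inf'_le _ hz).trans (by exact_mod_cast hammingDist_triangle x y z)
  refine abs_sub_le_iff.2 ⟨key x y, ?_⟩
  rw [hammingDist_comm]
  exact key y x

/-- Otherwise both decoded values are likely. Low energy places most of the mass near `ker g`, where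
the two values occupy well-separated sets, and the distance to one set violates the variance bound
`K`. -/
theorem IsExpanding.half_lt_sq_mean_sign {a b c : ℕ} {f : Matrix (Fin b) (Fin a) (ZMod 2)}
    {g : Matrix (Fin c) (Fin b) (ZMod 2)} {ε μ : ℝ} (hfg : IsExpanding f g ε μ)
    (hε : 0 < ε) (hμ : 0 < μ) (hb : 0 < b) {v : Fin b → ZMod 2} (hv : ∀ y, v ⬝ᵥ (f *ᵥ y) = 0)
    {e : (Fin b → ZMod 2) → Fin b → ZMod 2} (he : ∀ x, x + e x ∈ LinearMap.ker g.mulVecLin)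
    (hle : ∀ x, hammingNorm (e x) ≤ distTo x (LinearMap.ker g.mulVecLin))
    {P : (Fin b → ZMod 2) → ℝ} (hP : ∀ x, 0 ≤ P x) (hP1 : ∑ x, P x = 1) {K : ℝ}
    (hK : ∀ h : (Fin b → ZMod 2) → ℝ, (∀ x y, |h x - h y| ≤ (hammingDist x y : ℝ)) →
      ∑ x, P x * h x = 0 → ∑ x, P x * h x ^ 2 ≤ K)
    (hE : ∑ x, P x * ((hammingNorm (g *ᵥ x) : ℝ) / c) ≤ ε * μ / 400)
    (hbig : 200 * K < (μ * b) ^ 2) :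
    1 / 2 < (∑ x, P x * sign (v ⬝ᵥ (x + e x))) ^ 2 := by
  classical
  by_contra! hle2
  set Z := LinearMap.ker g.mulVecLin with hZ
  -- Elements of `ker g` with different values are `4θ` apart; two decoding errors below `θ` leave a
  -- separation of `2θ`.
  set θ : ℝ := μ * b / 4 with hθ
  have hb' : (0 : ℝ) < b := Nat.cast_pos.2 hb
  have hθ0 : 0 < θ := by positivity
  set s := ∑ x, P x * sign (v ⬝ᵥ (x + e x)) with hs
  set S : ZMod 2 → Finset (Fin b → ZMod 2) := fun r =>
    Finset.univ.filter fun x => v ⬝ᵥ (x + e x) = r ∧ (distTo x Z : ℝ) < θ with hS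
  set bad : ℝ := ∑ x, if (distTo x Z : ℝ) < θ then 0 else P x with hbad
  have hexp : ∀ x, ε * ((distTo x Z : ℝ) / b) ≤ (hammingNorm (g *ᵥ x) : ℝ) / c := by
    intro x
    by_cases hx : x ∈ Z
    · rw [distTo_eq_zero hx]
      simp only [Nat.cast_zero, zero_div, mul_zero]
      positivity
    · exact hfg.2 x hx
  -- Markov's inequality: by expansion, each bad point has relative syndrome weight at least `ε * θ
  -- / b = ε * μ / 4`.
  have hbad1 : bad ≤ 1 / 100 := by
    have h1 : bad * (ε * μ / 4) ≤ ∑ x, P x * ((hammingNorm (g *ᵥ x) : ℝ) / c) := by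
      rw [hbad, Finset.sum_mul]
      refine Finset.sum_le_sum fun x _ => ?_
      split_ifs with hx
      · rw [zero_mul]; exact mul_nonneg (hP x) (by positivity)
      · refine mul_le_mul_of_nonneg_left (le_trans ?_ (hexp x)) (hP x)
        rw [mul_div_assoc]
        refine mul_le_mul_of_nonneg_left ?_ hε.le
        rw [le_div_iff₀ hb']
        linarith [not_lt.1 hx]
    have h2 : 0 < ε * μ / 4 := by positivity
    have h3 : bad * (ε * μ / 4) ≤ 1 / 100 * (ε * μ / 4) := by linarith
    exact le_of_mul_le_mul_right h3 h2
  have hmass : ∀ r, (1 + sign r * s) / 2 - bad ≤ ∑ x ∈ S r, P x := by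
    intro r
    have : (1 + sign r * s) / 2 = ∑ x, P x * ((1 + sign r * sign (v ⬝ᵥ (x + e x))) / 2) := by
      have : (1 + sign r * s) / 2 = (∑ x, P x + sign r * s) / 2 := by rw [hP1]
      rw [this, hs, Finset.mul_sum, ← Finset.sum_add_distrib, Finset.sum_div]
      exact Finset.sum_congr rfl fun x _ => by ring
    rw [this, hbad, ← Finset.sum_sub_distrib, hS, Finset.sum_filter]
    refine Finset.sum_le_sum fun x _ => ?_
    have hPx := hP x
    rcases zmod_two_cases r with rfl | rfl <;>
      rcases zmod_two_cases (v ⬝ᵥ (x + e x)) with h | h <;>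
      by_cases hx : (distTo x Z : ℝ) < θ <;>
      simp [h, hx, sign_zero, sign_one] <;> linarith
  -- `18 / 25` slightly exceeds `1 / √2`; each value keeps mass at least `(1 - 18/25) / 2 - 1/100 =
  -- 13/100`.
  have hs2 : |s| ≤ 18 / 25 := abs_le_of_sq_le_sq (hle2.trans (by norm_num)) (by norm_num)
  have hs3 := abs_le.1 hs2
  have hp0 : 13 / 100 ≤ ∑ x ∈ S 0, P x := by
    have := hmass 0
    rw [sign_zero] at this
    linarith
  have hp1 : 13 / 100 ≤ ∑ x ∈ S 1, P x := by
    have := hmass 1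
    rw [sign_one] at this
    linarith
  have hne : (S 0).Nonempty := by
    by_contra h
    rw [Finset.not_nonempty_iff_eq_empty] at h
    rw [h, Finset.sum_empty] at hp0
    norm_num at hp0
  set h : (Fin b → ZMod 2) → ℝ := fun x => (S 0).inf' hne fun z => (hammingDist x z : ℝ) with hh
  have hzero : ∀ x ∈ S 0, h x ≤ 0 := fun x hx =>
    (Finset.inf'_le _ hx).trans (by simp)
  have hfar : ∀ y ∈ S 1, 2 * θ ≤ h y := by
    intro y hy
    refine Finset.le_inf' _ _ fun x hx => ?_
    obtain ⟨hy1, hy2⟩ := (Finset.mem_filter.1 hy).2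
    obtain ⟨hx1, hx2⟩ := (Finset.mem_filter.1 hx).2
    -- The difference of the decoded words pairs to 1 with `v`, which is orthogonal to `im f`, so it
    -- is not in `im f`.
    have hw := hfg.1 ((y + e y) - (x + e x)) (Z.sub_mem (he y) (he x)) (by
      rintro ⟨u, hu⟩
      have := hv u
      rw [← mulVecLin_apply, hu, dotProduct_sub, hy1, hx1] at this
      exact absurd this (by decide))
    rw [← hammingDist_eq_hammingNorm_sub] at hw
    have ht : hammingDist (y + e y) (x + e x) ≤
        hammingNorm (e y) + hammingDist y x + hammingNorm (e x) := by
      refine (hammingDist_triangle _ x _).trans (add_le_add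
        ((hammingDist_triangle _ y _).trans (add_le_add_left ?_ _)) ?_)
      · rw [hammingDist_eq_hammingNorm_sub, add_sub_cancel_left]
      · rw [hammingDist_comm, hammingDist_eq_hammingNorm_sub, add_sub_cancel_left]
    have ht' : (hammingDist (y + e y) (x + e x) : ℝ) ≤
        hammingNorm (e y) + hammingDist y x + hammingNorm (e x) := by exact_mod_cast ht
    have hey : (hammingNorm (e y) : ℝ) ≤ distTo y Z := by exact_mod_cast hle y
    have hex : (hammingNorm (e x) : ℝ) ≤ distTo x Z := by exact_mod_cast hle x
    linarith
  set m := ∑ x, P x * h x with hm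
  have hvar := hK (fun x => h x - m) (fun x y => by
    rw [sub_sub_sub_cancel_right]; exact abs_inf'_hammingDist_sub_le hne x y) (by
    simp only [mul_sub, Finset.sum_sub_distrib, ← Finset.sum_mul, hP1, ← hm, one_mul, sub_self])
  have hlow : ∀ T : Finset (Fin b → ZMod 2), (∀ x ∈ T, θ ≤ |h x - m|) →
      13 / 100 ≤ ∑ x ∈ T, P x → 13 / 100 * θ ^ 2 ≤ K := by
    intro T hT hpT
    refine le_trans ?_ hvar
    calc 13 / 100 * θ ^ 2 ≤ (∑ x ∈ T, P x) * θ ^ 2 := by gcongr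
      _ = ∑ x ∈ T, P x * θ ^ 2 := Finset.sum_mul _ _ _
      _ ≤ ∑ x ∈ T, P x * (h x - m) ^ 2 := Finset.sum_le_sum fun x hx => by
          rw [← sq_abs (h x - m)]
          exact mul_le_mul_of_nonneg_left (pow_le_pow_left₀ hθ0.le (hT x hx) 2) (hP x)
      _ ≤ ∑ x, P x * (h x - m) ^ 2 := Finset.sum_le_sum_of_subset_of_nonneg
          (Finset.subset_univ T) fun x _ _ => mul_nonneg (hP x) (sq_nonneg _)
  -- `h` is at most `0` on `S 0` and at least `2θ` on `S 1`, so its mean is `θ` away from one of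
  -- them.
  have hfin : 13 / 100 * θ ^ 2 ≤ K := by
    rcases le_total θ m with hθm | hθm
    · refine hlow (S 0) (fun x hx => ?_) hp0
      rw [le_abs]
      right
      linarith [hzero x hx]
    · refine hlow (S 1) (fun x hx => ?_) hp1
      rw [le_abs]
      left
      linarith [hfar x hx]
  -- Now `K ≥ 13 (μ b)² / 1600`, against `K < (μ b)² / 200 = 8 (μ b)² / 1600`.
  have : θ ^ 2 = (μ * b) ^ 2 / 16 := by rw [hθ]; ring
  nlinarith [sq_nonneg (μ * b)]

/-- A vector outside the range of `f` is detected by a vector orthogonal to the range. -/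
theorem exists_dotProduct_eq_one {a b : ℕ} {f : Matrix (Fin b) (Fin a) (ZMod 2)}
    {x : Fin b → ZMod 2} (hx : x ∉ LinearMap.range f.mulVecLin) :
    ∃ y, fᵀ *ᵥ y = 0 ∧ x ⬝ᵥ y = 1 := by
  obtain ⟨l, hl, hker⟩ := Submodule.exists_dual_map_eq_bot_of_notMem hx inferInstance
  obtain ⟨y, rfl⟩ := (dotProductEquiv (ZMod 2) (Fin b)).surjective l
  refine ⟨y, ?_, ?_⟩
  · funext i
    have hmem : y ⬝ᵥ (f *ᵥ Pi.single i 1) = 0 := by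
      have := Submodule.mem_map_of_mem (f := dotProductEquiv (ZMod 2) (Fin b) y)
        (LinearMap.mem_range_self f.mulVecLin (Pi.single i 1))
      rw [hker] at this
      simpa using this
    rw [dotProduct_mulVec, dotProduct_single, mul_one, ← mulVec_transpose] at hmem
    exact hmem
  · rcases zmod_two_cases (x ⬝ᵥ y) with h | h
    · exact absurd (by rw [dotProduct_comm] at h; simpa using h) hl
    · exact h

/-- Every shallow state has constant energy in the CSS Hamiltonian of a large systole/co-systole
expander with nontrivial middle homology. -/
theorem ThreeTermComplex.lt_trace_of_isTrivialState (C : ThreeTermComplex) {ε μ : ℝ}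
    (hε : 0 < ε) (hμ : 0 < μ) (hhom : C.HasNontrivialMiddleHomology)
    (hsys : C.IsSystoleExpander ε μ) (hcosys : C.IsCosystoleExpander ε μ) {d : ℕ}
    (hbig : 200 * 4 ^ (d + 1) < μ ^ 2 * C.n1) {ρ : Op (Fin C.n1)} (hρ : IsTrivialState d ρ) :
    ε * μ / 1600 < ((ρ * C.hamiltonian).trace).re := by
  obtain ⟨k, Ls, hlen, rfl⟩ := hρ
  rw [trace_partialTrace_mul, re_expect_hamiltonian]
  by_contra! hE
  have hn : 0 < C.n1 := by
    rcases C.n1.eq_zero_or_pos with h | h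
    · rw [h, Nat.cast_zero, mul_zero] at hbig
      exact absurd hbig (not_lt.2 (by positivity))
    · exact h
  have hn' : (0 : ℝ) < C.n1 := Nat.cast_pos.2 hn
  obtain ⟨a, ha, har⟩ : ∃ a, C.bd1 *ᵥ a = 0 ∧ a ∉ LinearMap.range C.bd2.mulVecLin := by
    by_contra! h
    refine hhom (le_antisymm ?_ fun a ha => h a ha)
    rintro _ ⟨u, rfl⟩
    rw [LinearMap.mem_ker, mulVecLin_apply, mulVecLin_apply, mulVec_mulVec, C.bd_comp, zero_mulVec]
  obtain ⟨b, hb, hab⟩ := exists_dotProduct_eq_one har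
  obtain ⟨e₁, he₁, hinv₁, hle₁⟩ := exists_coset_leader (LinearMap.ker C.bd1.mulVecLin)
  obtain ⟨e₂, he₂, hinv₂, hle₂⟩ := exists_coset_leader (LinearMap.ker C.bd2ᵀ.mulVecLin)
  set Bs : List (BlockLayer (Fin C.n1 ⊕ Fin k)) := Ls.map Layer.toBlockLayer with hBs
  have hφ : circuitState Ls = blockCircuitOp Bs *ᵥ Pi.single 0 1 := by
    rw [circuitState, circuitOp, blockCircuitOp, hBs, List.map_map]
    rfl
  have hψ : (hadamardLayer _ (Fin k)).toOp *ᵥ circuitState Ls =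
      blockCircuitOp (hadamardLayer _ (Fin k) :: Bs) *ᵥ Pi.single 0 1 := by
    rw [hφ, mulVec_mulVec, blockCircuitOp_cons]
  have hBlen : Bs.length = d := by rw [hBs, List.length_map, hlen]
  -- Depth `d + 1` covers both bases, the `X` basis needing the extra Hadamard layer.
  have hK : ∀ Bs' : List (BlockLayer (Fin C.n1 ⊕ Fin k)), Bs'.length ≤ d + 1 →
      ∀ h : (Fin C.n1 → ZMod 2) → ℝ, (∀ x y, |h x - h y| ≤ (hammingDist x y : ℝ)) →
      ∑ x, marginal (blockCircuitOp Bs' *ᵥ Pi.single 0 1) x * h x = 0 →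
      ∑ x, marginal (blockCircuitOp Bs' *ᵥ Pi.single 0 1) x * h x ^ 2 ≤ 4 ^ (d + 1) * C.n1 := by
    intro Bs' hB h hh hmean
    refine (sum_marginal_sq_le_of_lipschitz Bs' h hh hmean).trans ?_
    rw [Fintype.card_fin]
    gcongr
    norm_num
  have hbig' : 200 * (4 ^ (d + 1) * C.n1 : ℝ) < (μ * C.n1) ^ 2 := by
    nlinarith
  -- As both parts are nonnegative, energy at most `ε * μ / 1600` bounds each by `ε * μ / 800`,
  -- below the threshold `ε * μ / 400`.
  have hZ0 : 0 ≤ ∑ x, marginal (circuitState Ls) x *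
      ((hammingNorm (C.bd2ᵀ *ᵥ x) : ℝ) / C.n2) :=
    Finset.sum_nonneg fun x _ => mul_nonneg (marginal_nonneg _ x) (by positivity)
  have hX0 : 0 ≤ ∑ x, marginal ((hadamardLayer _ (Fin k)).toOp *ᵥ circuitState Ls) x *
      ((hammingNorm (C.bd1 *ᵥ x) : ℝ) / C.n0) :=
    Finset.sum_nonneg fun x _ => mul_nonneg (marginal_nonneg _ x) (by positivity)
  have hεμ : 0 < ε * μ := by positivity
  have hZ := IsExpanding.half_lt_sq_mean_sign hcosys hε hμ hn (v := a)
    (fun y => by rw [dotProduct_mulVec, vecMul_transpose, ha, zero_dotProduct]) he₂ hle₂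
    (P := marginal (circuitState Ls)) (marginal_nonneg _)
    (by rw [hφ]; exact sum_marginal_circuit _)
    (by rw [hφ]; exact hK Bs (by omega)) (by linarith) hbig'
  have hX := IsExpanding.half_lt_sq_mean_sign hsys hε hμ hn (v := b)
    (fun y => by rw [dotProduct_mulVec, ← mulVec_transpose, hb, zero_dotProduct]) he₁ hle₁
    (P := marginal ((hadamardLayer _ (Fin k)).toOp *ᵥ circuitState Ls)) (marginal_nonneg _)
    (by rw [hψ]; exact sum_marginal_circuit _)
    (by rw [hψ]; exact hK _ (by simp [hBlen])) (by linarith) hbig'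
  -- Coset leaders are unchanged by translation within the kernel, so the decoded signs transform by
  -- the characters `a` and `b`.
  have hle := C.sq_mean_add_sq_mean_le_one (φ := circuitState Ls)
    (by rw [hφ]; exact sum_marginal_circuit _) ha hb hab
    (s := fun x => sign (a ⬝ᵥ (x + e₂ x))) (t := fun x => sign (b ⬝ᵥ (x + e₁ x)))
    (fun x z hz => by
      rw [← sign_add, hinv₂ x z hz, ← dotProduct_add]
      congr 2
      abel)
    (fun x z hz => by
      rw [← sign_add, hinv₁ x z hz, ← dotProduct_add]
      congr 2
      abel)
    (fun _ => sign_mul_self _) (fun _ => sign_mul_self _)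
  linarith

end HighDimNLTS

/-! ### The asymptotic statement for the family -/

theorem mainTheorem5 (C : ℕ → HighDimNLTS.ThreeTermComplex) (ε μ : ℝ) (hε : 0 < ε) (hμ : 0 < μ)
    (q : ℕ)
    (hsize : Filter.Tendsto (fun n => (C n).n1) Filter.atTop Filter.atTop)
    (hweight : ∀ n, (C n).HasCheckWeightAtMost q)
    (hhom : ∀ n, (C n).HasNontrivialMiddleHomology)
    (hsys : ∀ n, (C n).IsSystoleExpander ε μ)
    (hcosys : ∀ n, (C n).IsCosystoleExpander ε μ) :
    HighDimNLTS.IsNLTS (fun n => (C n).n1) (fun n => (C n).hamiltonian) := by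
  refine ⟨⟨q, fun n => (C n).isLocalHamiltonian_hamiltonian (hweight n)⟩, ε * μ / 1600,
    by positivity, fun d => ?_⟩
  -- The depth affects only how large `n₁` must be, not the energy gap.
  have hlarge : ∀ᶠ n in atTop, 200 * 4 ^ (d + 1) / μ ^ 2 < ((C n).n1 : ℝ) :=
    (tendsto_natCast_atTop_atTop.comp hsize).eventually_gt_atTop _
  filter_upwards [hlarge] with n hn ρ hρ
  rw [div_lt_iff₀ (by positivity), mul_comm] at hn
  have h := (C n).lt_trace_of_isTrivialState hε hμ (hhom n) (hsys n) (hcosys n) (by linarith) hρ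
  linarith [(C n).lambdaMin_hamiltonian_nonpos]
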